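/- Let $E$ be an elliptic curve over a number field $F$, let $\bar F$ be an algebraic closure of $F$ and $G_F=\mathrm{Gal}(\bar F/F)$. For $n\ge 1$ let $E_n$ be the group of $n$-torsion points of $E(\bar F)$, let $\rho_{E,n}\colon G_F\to \mathrm{Aut}(E_n)\cong \mathrm{GL}_2(\mathbf Z/n\mathbf Z)$ be the Galois action on it, and let $\zeta_n\in\bar F$ denote a primitive $n$-th root of unity. Let $F^{(2)}=F(\boldsymbol\mu_{2^\infty})\subseteq\bar F$ be the field generated over $F$ by all roots of unity of $2$-power order, let $G_{F^{(2)}}=\mathrm{Gal}(\bar F/F^{(2)})\subseteq G_F$, and let $T_2(E)=\varprojlim_m E_{2^m}$ be the $2$-adic Tate module. Say that $E$ is $2$-full if $T_2(E)$ is a free $\mathbf Z_2$-module of finite nonzero rank and the natural homomorphism $\mathbf Z_2[G_{F^{(2)}}]\to \mathrm{End}_{\mathbf Z_2}(T_2(E))$ is surjective. Let $j>2$ be an integer such that $\zeta_{2^j}\notin F(\zeta_{2^{j-1}})$, and suppose that $\rho_{E,2^j}(G_F)$ contains $\mathrm{SL}_2(\mathbf Z/2^j\mathbf Z)$. Then $\rho_{E,2}(G_{F^{(2)}})=\mathrm{SL}_2(\mathbf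 F_2)$, and $E$ is $2$-full. -/

import Mathlib

open scoped Classical WeierstrassCurve.Affine

noncomputable section

universe u

/-- A representation of a group `N` on a `ℤ_ℓ`-module `S` is well-rounded if `S` is free of finite
(nonzero) rank over `ℤ_ℓ` and `ℤ_ℓ[N] → End_{ℤ_ℓ}(S)` is surjective. -/
structure IsWellRounded {ℓ : ℕ} [Fact ℓ.Prime] {N S : Type*} [Group N] [AddCommGroup S]
    [Module ℤ_[ℓ] S] (ρ : Representation ℤ_[ℓ] N S) : Prop where
  free : Module.Free ℤ_[ℓ] S
  finite : Module.Finite ℤ_[ℓ] S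
  nontrivial : Nontrivial S
  surjective : Function.Surjective ρ.asAlgebraHom

section Fields

variable (F : Type u) [Field F]

/-- `F^s`, a separable closure of `F`. -/
abbrev SepCl : Type u := SeparableClosure F

/-- `G_F = Gal(F^s / F)`. -/
abbrev AbsGal : Type u := SepCl F ≃ₐ[F] SepCl F

/-- `F^{(ℓ)} = F(μ_{ℓ^∞})`, inside `F^s`. -/
def cyclotomicTower (ℓ : ℕ) : IntermediateField F (SepCl F) :=
  IntermediateField.adjoin F {ζ | ∃ m : ℕ, ζ ^ ℓ ^ m = 1}

/-- `G_{F^{(ℓ)}} = Gal(F^s / F^{(ℓ)})`, as a subgroup of `G_F`. -/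
def galCyclotomicTower (ℓ : ℕ) : Subgroup (AbsGal F) :=
  (cyclotomicTower F ℓ).fixingSubgroup

end Fields

namespace WeierstrassCurve

variable {F : Type u} [Field F] (E : WeierstrassCurve F)

/-- The group `E(F^s)`. -/
abbrev SepPoint : Type u := (E⁄(SepCl F)).toAffine.Point

/-- `E_n`, the kernel of multiplication by `n` in `E(F^s)`. -/
abbrev Tors (n : ℕ) : Type u := AddSubgroup.torsionBy E.SepPoint (n : ℤ)

instance torsModule (n : ℕ) : Module (ZMod n) (E.Tors n) :=
  AddSubgroup.torsionBy.zmodModule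

/-- An element of `G_F`, acting on `E_n` through the coordinates of points. -/
def torsMap (n : ℕ) (σ : AbsGal F) : E.Tors n →ₗ[ZMod n] E.Tors n :=
  AddMonoidHom.toZModLinearMap n
    (((Affine.Point.map (W' := E) (σ : SepCl F →ₐ[F] SepCl F)).comp
      (AddSubgroup.torsionBy E.SepPoint (n : ℤ)).subtype).codRestrict
      (AddSubgroup.torsionBy E.SepPoint (n : ℤ)) (fun P => by
        have h : (n : ℤ) • (P : E.SepPoint) = 0 := P.2
        change (n : ℤ) • (Affine.Point.map (W' := E) (σ : SepCl F →ₐ[F] SepCl F)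
          (P : E.SepPoint)) = 0
        rw [← map_zsmul, h, map_zero]))

theorem coe_torsMap (n : ℕ) (σ : AbsGal F) (P : E.Tors n) :
    ((E.torsMap n σ P : E.Tors n) : E.SepPoint) =
      Affine.Point.map (W' := E) (σ : SepCl F →ₐ[F] SepCl F) (P : E.SepPoint) := rfl

theorem torsMap_one (n : ℕ) : E.torsMap n 1 = 1 := by
  ext P
  rw [coe_torsMap]
  rcases (P : E.SepPoint) with _ | _ <;> rfl

theorem torsMap_mul (n : ℕ) (σ τ : AbsGal F) :
    E.torsMap n (σ * τ) = E.torsMap n σ * E.torsMap n τ := by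
  ext P
  rw [Module.End.mul_apply, coe_torsMap, coe_torsMap, coe_torsMap]
  rcases (P : E.SepPoint) with _ | _ <;> rfl

/-- The mod `n` representation as a homomorphism to the monoid of endomorphisms. -/
def torsRep (n : ℕ) : Representation (ZMod n) (AbsGal F) (E.Tors n) where
  toFun := E.torsMap n
  map_one' := E.torsMap_one n
  map_mul' := E.torsMap_mul n

/-- The mod `n` representation `ρ_{E,n} : G_F → Aut(E_n)`. -/
def modRep (n : ℕ) : AbsGal F →* (E.Tors n ≃ₗ[ZMod n] E.Tors n) :=
  (LinearMap.GeneralLinearGroup.generalLinearEquiv (ZMod n) (E.Tors n)).toMonoidHom.comp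
    (E.torsRep n).toHomUnits

/-- `SL(E_n)`, the automorphisms of `E_n` of determinant `1`; a basis of `E_n` over `ℤ/n`
identifies it with `SL₂(ℤ/n)`. -/
def slTors (n : ℕ) : Subgroup (E.Tors n ≃ₗ[ZMod n] E.Tors n) :=
  (LinearEquiv.det (R := ZMod n) (M := E.Tors n)).ker

theorem coe_modRep (n : ℕ) (σ : AbsGal F) (P : E.Tors n) :
    ((E.modRep n σ P : E.Tors n) : E.SepPoint) =
      Affine.Point.map (W' := E) (σ : SepCl F →ₐ[F] SepCl F) (P : E.SepPoint) := rfl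

theorem mem_slTors_iff (n : ℕ) (b : Module.Basis (Fin 2) (ZMod n) (E.Tors n))
    (f : E.Tors n ≃ₗ[ZMod n] E.Tors n) :
    f ∈ E.slTors n ↔ (LinearMap.toMatrix b b (f : E.Tors n →ₗ[ZMod n] E.Tors n)).det = 1 := by
  rw [LinearMap.det_toMatrix, ← LinearEquiv.coe_det, Units.val_eq_one]
  rfl

section Tate

variable (ℓ : ℕ) [Fact ℓ.Prime]

/-- `ℤ_ℓ` acts on `E_{ℓ^m}` through `ℤ_ℓ → ℤ/ℓ^m`. -/
instance torsPadicModule (m : ℕ) : Module ℤ_[ℓ] (E.Tors (ℓ ^ m)) :=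
  Module.compHom _ (PadicInt.toZModPow (p := ℓ) m)

theorem padic_smul_def (m : ℕ) (a : ℤ_[ℓ]) (P : E.Tors (ℓ ^ m)) :
    a • P = PadicInt.toZModPow m a • P := rfl

theorem coe_zmod_smul (n : ℕ) [NeZero n] (a : ZMod n) (P : E.Tors n) :
    ((a • P : E.Tors n) : E.SepPoint) = a.val • (P : E.SepPoint) := by
  conv_lhs => rw [← ZMod.natCast_zmod_val a, Nat.cast_smul_eq_nsmul]
  rfl

/-- The Tate module `T_ℓ(E)`: the sequences `(P_m)` with `P_m ∈ E_{ℓ^m}` and `ℓ P_{m+1} = P_m`. -/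
def tateModule : Submodule ℤ_[ℓ] (∀ m : ℕ, E.Tors (ℓ ^ m)) where
  carrier := {P | ∀ m, ℓ • (P (m + 1) : E.SepPoint) = (P m : E.SepPoint)}
  zero_mem' m := by simp
  add_mem' {P Q} hP hQ m := by
    simp only [Set.mem_ofPred_eq] at hP hQ
    simp [hP m, hQ m]
  smul_mem' a P hP m := by
    simp only [Set.mem_ofPred_eq] at hP
    have hℓ : NeZero ℓ := ⟨(Fact.out : ℓ.Prime).ne_zero⟩
    have h1 : ((PadicInt.toZModPow (p := ℓ) (m + 1) a).val : ZMod (ℓ ^ m)) =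
        PadicInt.toZModPow (p := ℓ) m a := by
      rw [ZMod.natCast_val, PadicInt.cast_toZModPow _ _ (Nat.le_succ m)]
    have h2 : ((a • P) m : E.SepPoint) =
        (PadicInt.toZModPow (p := ℓ) (m + 1) a).val • (P m : E.SepPoint) := by
      rw [Pi.smul_apply, padic_smul_def, ← h1, Nat.cast_smul_eq_nsmul]
      rfl
    rw [h2, Pi.smul_apply, padic_smul_def, coe_zmod_smul, smul_comm, hP m]

/-- An element of `G_F`, acting on `T_ℓ(E)` componentwise. -/
def tateMap (σ : AbsGal F) : E.tateModule ℓ →ₗ[ℤ_[ℓ]] E.tateModule ℓ where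
  toFun P := ⟨fun m => E.torsMap (ℓ ^ m) σ (P.1 m), fun m => by
    rw [coe_torsMap, coe_torsMap, ← map_nsmul, P.2 m]⟩
  map_add' P Q := by
    ext m : 2
    exact map_add (E.torsMap (ℓ ^ m) σ) (P.1 m) (Q.1 m)
  map_smul' a P := by
    ext m : 2
    exact map_smul (E.torsMap (ℓ ^ m) σ) (PadicInt.toZModPow (p := ℓ) m a) (P.1 m)

/-- The `ℓ`-adic representation of `G_F` on `T_ℓ(E)`. -/
def tateRep : Representation ℤ_[ℓ] (AbsGal F) (E.tateModule ℓ) where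
  toFun := E.tateMap ℓ
  map_one' := by
    ext P m : 3
    exact LinearMap.congr_fun (E.torsMap_one (ℓ ^ m)) (P.1 m)
  map_mul' σ τ := by
    ext P m : 3
    exact LinearMap.congr_fun (E.torsMap_mul (ℓ ^ m) σ τ) (P.1 m)

/-- `E` is `ℓ`-full if the `ℤ_ℓ[G_{F^{(ℓ)}}]`-module `T_ℓ(E)` is well-rounded
(a notion used for `E` elliptic and `ℓ ≠ char F`). -/
def IsFull : Prop :=
  IsWellRounded ((E.tateRep ℓ).comp (galCyclotomicTower F ℓ).subtype)

end Tate

end WeierstrassCurve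

end

set_option linter.unusedSectionVars false

/-! ### The function field, its generic point and the valuation at infinity -/

noncomputable section

open Polynomial WithZero
open scoped Polynomial.Bivariate

namespace WeierstrassCurve

/-! The aim is to realise both elementary transvections of E_2 by elements of G_{F^(2)}. Given a
basis P, Q of E_{2^j}, the hypothesis on SL_2 yields σ in G_F that fixes P and sends Q to Q + P. The
Weil pairing e(P, Q) is a primitive 2^j-th root of unity, and e(P, Q + P) = e(P, Q), so σ fixes
μ_{2^j}.

On the cyclotomic side, let κ fix ζ_{2^(j-1)} but not ζ_{2^j}. Since GL_2(F_2) has exponent 6, κ^6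
is trivial on E_2. As j > 2, κ fixes i, which makes κ^6 fix ζ_{2^j} and negate ζ_{2^(j+1)}. Repeated
squaring gives, for every m ≥ j, an element trivial on E_2 that fixes ζ_{2^m} and negates
ζ_{2^(m+1)} (`map_root_sq`). Multiplying σ by such elements makes it fix μ_{2^m} without changing
its action on E_2 (`exists_correction`), and compactness of G_F produces one element that does so
for all m (`exists_mem_galCyclotomicTower_transvection`).

The two transvections generate GL_2(F_2) = SL_2(F_2). Together with 1 and their product they span
M_2(F_2), so Nakayama's lemma makes the group ring surject onto End(T_2)
(`asAlgebraHom_surjective_of_transvections`).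

Only a fragment of the Weil pairing is built. Put n = 2^j and let g be a function with divisor
[n]^*((P) - (O)). Translation by Q multiplies g by a constant ζ, translation by P fixes g
(`translate_self`), and σ fixes g up to a constant; hence σ fixes ζ (`exists_pow_eq_neg_one`). In
place of general non-degeneracy, `translate_half` gives ζ^(n/2) = -1. Divisors are read off from the
single valuation at O, transported by translations. The functions come from Abel's theorem, which
follows from the divisors of the functions x - x(P). -/

instance isElliptic_baseChange {F : Type*} [Field F] (E : WeierstrassCurve F) [E.IsElliptic]
    (K : Type*) [Field K] [Algebra F K] : (E⁄K).IsElliptic :=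
  inferInstanceAs (E.map (algebraMap F K)).IsElliptic

/-- A field `L` presented as the function field of `E` over `K`, with its generic point `(x, y)`
and the valuation at the point at infinity. -/
structure GenericPoint {F : Type*} [Field F] (E : WeierstrassCurve F) (K L : Type*) [Field K]
    [Field L] [Algebra F K] [Algebra F L] [Algebra K L] where
  /-- the first coordinate of the generic point -/
  x : L
  /-- the second coordinate of the generic point -/
  y : L
  /-- the valuation at the point at infinity -/
  v : Valuation L ℤᵐ⁰
  equation : (E⁄L).toAffine.Equation x y
  v_algebraMap : ∀ c : K, c ≠ 0 → v (algebraMap K L c) = 1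
  v_x : v x = exp 2
  v_y : v y = exp 3
  exists_eq : ∀ g : L, ∃ p q r : K[X], r ≠ 0 ∧ g * aeval x r = aeval x p + aeval x q * y
  exists_lift : ∀ (φ : K →ₐ[F] L) (x' y' : L), (E⁄L).toAffine.Equation x' y' →
    (∀ p : K[X], p ≠ 0 → p.eval₂ (φ : K →+* L) x' ≠ 0) →
    ∃ θ : L →ₐ[F] L, (∀ c, θ (algebraMap K L c) = φ c) ∧ θ x = x' ∧ θ y = y'

namespace Affine.CoordinateRing

variable {K : Type*} [Field K] (W : Affine K)

instance : Module.Finite K[X] W.CoordinateRing := .of_basis (CoordinateRing.basis W)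

/-- The norm of p + qY has degree max(2 deg p, 2 deg q + 3), so the bound reduces to the one for the
degrees of p and q. It is the ultrametric inequality for the pole order at infinity. -/
lemma degree_norm_add_le (a b : W.CoordinateRing) : (Algebra.norm K[X] (a + b)).degree ≤
    max (Algebra.norm K[X] a).degree (Algebra.norm K[X] b).degree := by
  obtain ⟨p, q, rfl⟩ := exists_smul_basis_eq a
  obtain ⟨p', q', rfl⟩ := exists_smul_basis_eq b
  have h : p • (1 : W.CoordinateRing) + q • mk W Y + (p' • (1 : W.CoordinateRing) + q' • mk W Y) =
      (p + p') • (1 : W.CoordinateRing) + (q + q') • mk W Y := by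
    simp only [add_smul]; abel
  have key : ∀ s t : K[X], (2 : ℕ) • (s + t).degree ≤ max (2 • s.degree) (2 • t.degree) := by
    intro s t
    rcases le_max_iff.mp (degree_add_le s t) with h | h
    · exact le_max_of_le_left (nsmul_le_nsmul_right h 2)
    · exact le_max_of_le_right (nsmul_le_nsmul_right h 2)
  rw [h]
  simp only [degree_norm_smul_basis]
  refine max_le ?_ ?_
  · rcases le_max_iff.mp (key p p') with h | h
    · exact le_max_of_le_left (le_max_of_le_left h)
    · exact le_max_of_le_right (le_max_of_le_left h)
  · rcases le_max_iff.mp (key q q') with h | h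
    · exact le_max_of_le_left (le_max_of_le_right (by gcongr))
    · exact le_max_of_le_right (le_max_of_le_right (by gcongr))

/-- The order of the pole at infinity, as a valuation of the coordinate ring. -/
def infinityValuation : Valuation W.CoordinateRing ℤᵐ⁰ where
  toFun a := if a = 0 then 0 else exp ((Algebra.norm K[X] a).natDegree : ℤ)
  map_zero' := if_pos rfl
  map_one' := by simp
  map_mul' a b := by
    by_cases ha : a = 0
    · simp [ha]
    by_cases hb : b = 0
    · simp [hb]
    have hN : ∀ c : W.CoordinateRing, c ≠ 0 → Algebra.norm K[X] c ≠ 0 := fun c hc =>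
      Algebra.norm_ne_zero_iff.mpr hc
    rw [if_neg (mul_ne_zero ha hb), if_neg ha, if_neg hb, map_mul,
      natDegree_mul (hN a ha) (hN b hb), ← exp_add, Nat.cast_add]
  map_add_le_max' a b := by
    by_cases ha : a = 0
    · simp [ha]
    by_cases hb : b = 0
    · simp [hb]
    by_cases hab : a + b = 0
    · simp [hab]
    have hN : ∀ c : W.CoordinateRing, c ≠ 0 → Algebra.norm K[X] c ≠ 0 := fun c hc =>
      Algebra.norm_ne_zero_iff.mpr hc
    rw [if_neg hab, if_neg ha, if_neg hb, le_max_iff, exp_le_exp, exp_le_exp, Nat.cast_le,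
      Nat.cast_le]
    exact (le_max_iff.mp (degree_norm_add_le W a b)).imp natDegree_le_natDegree
      natDegree_le_natDegree

lemma infinityValuation_apply {a : W.CoordinateRing} (ha : a ≠ 0) :
    infinityValuation W a = exp ((Algebra.norm K[X] a).natDegree : ℤ) :=
  if_neg ha

/-- The extension of the valuation at infinity to the function field. -/
def functionFieldValuation : Valuation W.FunctionField ℤᵐ⁰ :=
  (infinityValuation W).extendToLocalization (S := nonZeroDivisors W.CoordinateRing)
    (show nonZeroDivisors W.CoordinateRing ≤ (infinityValuation W).supp.primeCompl from
      fun a ha h => by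
      have h0 := nonZeroDivisors.ne_zero ha
      rw [SetLike.mem_coe, Valuation.mem_supp_iff, infinityValuation_apply W h0] at h
      exact exp_ne_zero h) W.FunctionField

lemma functionFieldValuation_smul_basis {p q : K[X]} {n : ℕ} 
    (h : max (2 • p.degree) (2 • q.degree + 3) = n) :
    functionFieldValuation W (algebraMap W.CoordinateRing W.FunctionField
      (p • (1 : W.CoordinateRing) + q • mk W Y)) = exp (n : ℤ) := by
  have hd := degree_norm_smul_basis (W' := W) p q
  rw [h] at hd
  have h0 : p • (1 : W.CoordinateRing) + q • mk W Y ≠ 0 := by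
    -- The hypothesis on the degrees excludes p = q = 0, where the maximum would be ⊥.
    intro h0
    rw [h0, Algebra.norm_zero] at hd
    simp at hd
  rw [functionFieldValuation, Valuation.extendToLocalization_apply_map_apply,
    infinityValuation_apply W h0, natDegree_eq_of_degree_eq_some hd]

/-- The ring homomorphism from the coordinate ring defined by a point over an extension. -/
def evalHom {L : Type*} [Field L] (φ : K →+* L) (x' y' : L)
    (h : (W.map φ).toAffine.Equation x' y') : W.CoordinateRing →+* L :=
  AdjoinRoot.lift (eval₂RingHom φ x') y' <| by
    rw [equation_iff] at h
    simp only [map_a₁, map_a₂, map_a₃, map_a₄, map_a₆] at h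
    simp only [polynomial, eval₂_add, eval₂_sub, eval₂_mul, eval₂_pow, eval₂_X, eval₂_C,
      coe_eval₂RingHom]
    linear_combination h

lemma evalHom_smul_basis {L : Type*} [Field L] (φ : K →+* L) (x' y' : L)
    (h : (W.map φ).toAffine.Equation x' y') (p q : K[X]) :
    evalHom W φ x' y' h (p • (1 : W.CoordinateRing) + q • mk W Y) =
      p.eval₂ φ x' + q.eval₂ φ x' * y' := by
  simp [CoordinateRing.smul, evalHom]

/-- If an element is sent to 0, so is its norm, which is the element times its conjugate. The norm
is a polynomial in x alone, and no nonzero polynomial vanishes at x'. -/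
lemma evalHom_injective {L : Type*} [Field L] (φ : K →+* L) (x' y' : L)
    (h : (W.map φ).toAffine.Equation x' y') (hx : ∀ p : K[X], p ≠ 0 → p.eval₂ φ x' ≠ 0) :
    Function.Injective (evalHom W φ x' y' h) := by
  rw [injective_iff_map_eq_zero]
  intro a ha
  by_contra h0
  refine hx (Algebra.norm K[X] a) (Algebra.norm_ne_zero_iff.mpr h0) ?_
  obtain ⟨p, q, rfl⟩ := exists_smul_basis_eq a
  rw [evalHom_smul_basis] at ha
  rw [equation_iff] at h
  simp only [map_a₁, map_a₂, map_a₃, map_a₄, map_a₆] at h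
  rw [norm_smul_basis]
  simp only [eval₂_add, eval₂_sub, eval₂_mul, eval₂_pow, eval₂_X, eval₂_C]
  linear_combination (p.eval₂ φ x' + q.eval₂ φ x' * (-y' - φ W.a₁ * x' - φ W.a₃)) * ha +
    (q.eval₂ φ x') ^ 2 * h

end Affine.CoordinateRing

namespace Affine.CoordinateRing

variable {K : Type*} [Field K] (W : Affine K)

/-- The cofactor is the conjugate under Y ↦ -Y - a₁X - a₃. It serves to rationalise denominators. -/
lemma exists_norm_eq_mul (b : W.CoordinateRing) :
    ∃ b', algebraMap K[X] W.CoordinateRing (Algebra.norm K[X] b) = b * b' := by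
  obtain ⟨p, q, rfl⟩ := exists_smul_basis_eq b
  refine ⟨mk W (C p + C q * (-(Y : K[X][Y]) - C (C W.a₁ * X + C W.a₃))), ?_⟩
  have h : p • (1 : W.CoordinateRing) + q • mk W Y = mk W (C p + C q * X) := by
    simp [CoordinateRing.smul]
  refine (coe_norm_smul_basis (W' := W) p q).trans ?_
  rw [map_mul, h]

lemma algebraMap_eq_aeval (p : K[X]) :
    algebraMap W.CoordinateRing W.FunctionField (algebraMap K[X] _ p) =
      aeval (algebraMap W.CoordinateRing W.FunctionField (algebraMap K[X] _ X)) p := by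
  rw [aeval_algebraMap_apply, aeval_algebraMap_apply, aeval_X_left_apply]

lemma algebraMap_smul_basis (p q : K[X]) :
    algebraMap W.CoordinateRing W.FunctionField (p • (1 : W.CoordinateRing) + q • mk W Y) =
      aeval (algebraMap W.CoordinateRing W.FunctionField (algebraMap K[X] _ X)) p +
      aeval (algebraMap W.CoordinateRing W.FunctionField (algebraMap K[X] _ X)) q *
        algebraMap W.CoordinateRing W.FunctionField (mk W Y) := by
  rw [← algebraMap_eq_aeval, ← algebraMap_eq_aeval, map_add, Algebra.smul_def, Algebra.smul_def,
    map_mul, map_mul, map_one, mul_one]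

lemma equation_generic : (W.map (algebraMap K W.FunctionField)).toAffine.Equation
    (algebraMap W.CoordinateRing W.FunctionField (algebraMap K[X] _ X))
    (algebraMap W.CoordinateRing W.FunctionField (mk W Y)) := by
  have h : algebraMap W.CoordinateRing W.FunctionField (AdjoinRoot.mk W.polynomial
      (Y ^ 2 + C (C W.a₁ * X + C W.a₃) * Y - C (X ^ 3 + C W.a₂ * X ^ 2 + C W.a₄ * X + C W.a₆))) =
      0 := by
    have h2 := AdjoinRoot.mk_self (f := W.polynomial)
    exact (congrArg _ h2).trans (map_zero _)
  rw [equation_iff]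
  have hc : ∀ c : K, algebraMap K W.FunctionField c =
      algebraMap W.CoordinateRing W.FunctionField (AdjoinRoot.mk W.polynomial (C (C c))) := fun c => rfl
  have hX : (algebraMap K[X] W.CoordinateRing X) = AdjoinRoot.mk W.polynomial (C X) := rfl
  simp only [map_a₁, map_a₂, map_a₃, map_a₄, map_a₆, hc, hX]
  simp only [map_add, map_sub, map_mul, map_pow] at h
  linear_combination h

end Affine.CoordinateRing

open Affine.CoordinateRing in
/-- The generic point of a Weierstrass curve over its function field. -/
theorem nonempty_genericPoint {F : Type*} [Field F] (E : WeierstrassCurve F) (K : Type*) [Field K]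
    [Algebra F K] : Nonempty (GenericPoint E K (E⁄K).toAffine.FunctionField) := by
  have hE : (E⁄K).toAffine.map (algebraMap K (E⁄K).toAffine.FunctionField) =
      E⁄((E⁄K).toAffine.FunctionField) := by
    refine (E.map_map _ _).trans ?_
    rw [← IsScalarTower.algebraMap_eq]
    rfl
  refine ⟨{
    x := algebraMap (E⁄K).toAffine.CoordinateRing _ (algebraMap K[X] _ X)
    y := algebraMap (E⁄K).toAffine.CoordinateRing _ (Affine.CoordinateRing.mk (E⁄K).toAffine Y)
    v := functionFieldValuation (E⁄K).toAffine
    equation := ?_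
    v_algebraMap := ?_
    v_x := ?_
    v_y := ?_
    exists_eq := ?_
    exists_lift := ?_ }⟩
  · rw [← hE]
    exact equation_generic _
  · intro c hc
    have h := functionFieldValuation_smul_basis (E⁄K).toAffine (p := C c) (q := 0) (n := 0)
      (by rw [degree_C hc]; simp)
    rw [algebraMap_smul_basis] at h
    simpa using h
  · have h := functionFieldValuation_smul_basis (E⁄K).toAffine (p := X) (q := 0) (n := 2)
      (by rw [degree_X]; simp)
    rw [algebraMap_smul_basis] at h
    simpa using h
  · have h := functionFieldValuation_smul_basis (E⁄K).toAffine (p := 0) (q := 1) (n := 3)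
      (by rw [degree_one]; simp)
    rw [algebraMap_smul_basis] at h
    simpa using h
  · intro g
    obtain ⟨a, b, hb, rfl⟩ := IsFractionRing.div_surjective (A := (E⁄K).toAffine.CoordinateRing) g
    obtain ⟨b', hb'⟩ := exists_norm_eq_mul _ b
    obtain ⟨p, q, hpq⟩ := exists_smul_basis_eq (a * b')
    have hb0 := nonZeroDivisors.ne_zero hb
    refine ⟨p, q, Algebra.norm K[X] b, Algebra.norm_ne_zero_iff.mpr hb0, ?_⟩
    rw [← algebraMap_smul_basis, hpq, ← algebraMap_eq_aeval, hb', map_mul, map_mul]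
    have : algebraMap (E⁄K).toAffine.CoordinateRing (E⁄K).toAffine.FunctionField b ≠ 0 :=
      (map_ne_zero_iff _ (IsFractionRing.injective _ _)).mpr hb0
    field_simp
  · intro φ x' y' h hx
    have hE' : (E⁄K).toAffine.map (φ : K →+* (E⁄K).toAffine.FunctionField) =
        E⁄((E⁄K).toAffine.FunctionField) := by
      refine (E.map_map _ _).trans ?_
      rw [φ.comp_algebraMap]
      rfl
    have h' : ((E⁄K).toAffine.map (φ : K →+* (E⁄K).toAffine.FunctionField)).toAffine.Equation
      x' y' := by rwa [hE']
    let θ : (E⁄K).toAffine.FunctionField →+* (E⁄K).toAffine.FunctionField :=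
      IsFractionRing.lift (evalHom_injective (E⁄K).toAffine _ x' y' h' hx)
    have hθ : ∀ p q : K[X], θ (algebraMap _ _ (p • (1 : (E⁄K).toAffine.CoordinateRing) +
        q • Affine.CoordinateRing.mk (E⁄K).toAffine Y)) =
        p.eval₂ (φ : K →+* _) x' + q.eval₂ (φ : K →+* _) x' * y' := fun p q => by
      rw [← evalHom_smul_basis (E⁄K).toAffine _ x' y' h']
      exact IsFractionRing.lift_algebraMap _ _
    have hc : ∀ c, θ (algebraMap K _ c) = φ c := fun c => by
      have := hθ (C c) 0
      rw [algebraMap_smul_basis] at this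
      simpa using this
    refine ⟨{ θ with commutes' := fun c => ?_ }, hc, ?_, ?_⟩
    · rw [IsScalarTower.algebraMap_apply F K]
      exact (hc _).trans (φ.commutes c)
    · have := hθ X 0
      rw [algebraMap_smul_basis] at this
      simpa using this
    · have := hθ 0 1
      rw [algebraMap_smul_basis] at this
      simpa using this

end WeierstrassCurve

end

/-! ### Translations and Galois conjugation on the function field -/

noncomputable section

open Polynomial WithZero

namespace WeierstrassCurve.GenericPoint

/-- The inclusion of constant points. -/
def constPoint {F : Type*} [Field F] (E : WeierstrassCurve F) (K L : Type*) [Field K] [Field L]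
    [Algebra F K] [Algebra F L] [Algebra K L] [IsScalarTower F K L] :
    (E⁄K).toAffine.Point →+ (E⁄L).toAffine.Point :=
  Affine.Point.map (W' := E) (IsScalarTower.toAlgHom F K L)

variable {F K L : Type*} [Field F] [Field K] [Field L] [Algebra F K] [Algebra F L] [Algebra K L]
  {E : WeierstrassCurve F} (G : GenericPoint E K L)

lemma v_algebraMap_le (c : K) : G.v (algebraMap K L c) ≤ 1 := by
  by_cases hc : c = 0
  · simp [hc]
  · exact (G.v_algebraMap c hc).le

/-- The leading term dominates, because x has a pole at infinity and constants have value at most 1.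
-/
lemma v_aeval {p : K[X]} (hp : p ≠ 0) : G.v (aeval G.x p) = exp (2 * p.natDegree : ℤ) := by
  induction hn : p.natDegree generalizing p with
  | zero =>
    obtain ⟨c, rfl⟩ := natDegree_eq_zero.mp hn
    rw [aeval_C, G.v_algebraMap c (by simpa using hp)]
    simp
  | succ n ih =>
    have hd : p.divX.natDegree = n := by rw [natDegree_divX_eq_natDegree_tsub_one, hn]; rfl
    have hd0 : p.divX ≠ 0 := fun h => by
      rw [divX_eq_zero_iff] at h
      rw [h, natDegree_C] at hn
      omega
    have h1 : G.v (aeval G.x p.divX * G.x) = exp (2 * (n + 1 : ℕ) : ℤ) := by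
      rw [map_mul, ih hd0 hd, G.v_x, ← exp_add]
      congr 1
    rw [← divX_mul_X_add p, map_add, map_mul, aeval_X, aeval_C, Valuation.map_add_eq_of_lt_left, h1]
    · rw [h1]
      refine (G.v_algebraMap_le _).trans_lt ?_
      rw [← exp_zero, exp_lt_exp]
      positivity

lemma aeval_ne_zero {p : K[X]} (hp : p ≠ 0) : aeval G.x p ≠ 0 := fun h => by
  have := G.v_aeval hp
  rw [h, map_zero] at this
  exact exp_ne_zero this.symm

lemma v_aeval_mul_y {q : K[X]} (hq : q ≠ 0) :
    G.v (aeval G.x q * G.y) = exp (2 * q.natDegree + 3 : ℤ) := by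
  rw [map_mul, G.v_aeval hq, G.v_y, ← exp_add]

/-- The pole orders of p(x) and q(x)y are even and odd respectively, so they never cancel. -/
lemma v_form {p q : K[X]} : G.v (aeval G.x p + aeval G.x q * G.y) =
    max (G.v (aeval G.x p)) (G.v (aeval G.x q * G.y)) := by
  by_cases hp : p = 0
  · simp [hp]
  by_cases hq : q = 0
  · simp [hq]
  refine Valuation.map_add_of_distinct_val _ ?_
  rw [G.v_aeval hp, G.v_aeval_mul_y hq, Ne, exp_inj]
  omega

lemma eq_C_of_v_form_le_one {p q : K[X]} (h : G.v (aeval G.x p + aeval G.x q * G.y) ≤ 1) :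
    ∃ c, p = C c ∧ q = 0 := by
  rw [v_form, max_le_iff] at h
  have hq : q = 0 := by
    by_contra hq
    rw [G.v_aeval_mul_y hq, ← exp_zero, exp_le_exp] at h
    omega
  have hp : p.natDegree = 0 := by
    by_cases hp : p = 0
    · simp [hp]
    rw [G.v_aeval hp, ← exp_zero, exp_le_exp] at h
    omega
  obtain ⟨c, hc⟩ := natDegree_eq_zero.mp hp
  exact ⟨c, hc.symm, hq⟩

lemma x_ne (c : K) : G.x ≠ algebraMap K L c := fun h => by
  have := G.aeval_ne_zero (X_sub_C_ne_zero c)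
  simp [h] at this

lemma v_x_sub (c : K) : G.v (G.x - algebraMap K L c) = exp 2 := by
  have := G.v_aeval (X_sub_C_ne_zero c)
  simpa using this

lemma algHom_ext {θ θ' : L →ₐ[F] L} (hK : ∀ c : K, θ (algebraMap K L c) = θ' (algebraMap K L c))
    (hx : θ G.x = θ' G.x) (hy : θ G.y = θ' G.y) : θ = θ' := by
  have hp : ∀ p : K[X], θ (aeval G.x p) = θ' (aeval G.x p) := by
    intro p
    induction p using Polynomial.induction_on' with
    | add p q hp hq => simp only [map_add, hp, hq]
    | monomial n a => simp only [aeval_monomial, map_mul, map_pow, hK, hx]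
  ext g
  obtain ⟨p, q, r, hr, h⟩ := G.exists_eq g
  have h1 := congrArg θ h
  have h2 := congrArg θ' h
  simp only [map_add, map_mul, hp, hy] at h1 h2
  refine mul_right_cancel₀ (b := θ' (aeval G.x r)) ?_ (h1.trans h2.symm)
  exact (map_ne_zero_iff _ θ'.toRingHom.injective).mpr (G.aeval_ne_zero hr)

lemma mem_range_of_aeval_eq_zero [IsAlgClosed K] {z : L} {p : K[X]} (hp : p ≠ 0)
    (h : aeval z p = 0) : ∃ c : K, algebraMap K L c = z := by
  have hz : _root_.IsIntegral K z := isAlgebraic_iff_isIntegral.mp ⟨p, hp, h⟩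
  exact minpoly.mem_range_of_degree_eq_one K z
    (IsAlgClosed.degree_eq_one_of_irreducible K (minpoly.irreducible hz))

section Tower

variable [IsScalarTower F K L]

lemma algebraMap_a₁ : (E⁄L).a₁ = algebraMap K L (E⁄K).a₁ := IsScalarTower.algebraMap_apply F K L _
lemma algebraMap_a₂ : (E⁄L).a₂ = algebraMap K L (E⁄K).a₂ := IsScalarTower.algebraMap_apply F K L _
lemma algebraMap_a₃ : (E⁄L).a₃ = algebraMap K L (E⁄K).a₃ := IsScalarTower.algebraMap_apply F K L _
lemma algebraMap_a₄ : (E⁄L).a₄ = algebraMap K L (E⁄K).a₄ := IsScalarTower.algebraMap_apply F K L _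
lemma algebraMap_a₆ : (E⁄L).a₆ = algebraMap K L (E⁄K).a₆ := IsScalarTower.algebraMap_apply F K L _

lemma equation_const {a b : K} : (E⁄L).toAffine.Equation (algebraMap K L a) (algebraMap K L b) ↔
    (E⁄K).toAffine.Equation a b := by
  rw [Affine.equation_iff', Affine.equation_iff', algebraMap_a₁ (K := K), algebraMap_a₂ (K := K),
    algebraMap_a₃ (K := K), algebraMap_a₄ (K := K), algebraMap_a₆ (K := K)]
  simp only [← map_mul, ← map_pow, ← map_add, ← map_sub]
  exact map_eq_zero_iff _ (algebraMap K L).injective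

end Tower

variable [E.IsElliptic]

lemma nonsingular : (E⁄L).toAffine.Nonsingular G.x G.y :=
  Affine.equation_iff_nonsingular.mp G.equation

/-- The generic point, as a point. -/
def pt : (E⁄L).toAffine.Point := .some G.x G.y G.nonsingular

variable [IsScalarTower F K L]

lemma pt_ne_const (P : (E⁄K).toAffine.Point) : G.pt ≠ constPoint E K L P := by
  rcases P with _ | ⟨a, b, h⟩
  · exact fun h => by cases h
  · intro h
    injection h with h _
    exact G.x_ne a h

lemma exists_const_eq [IsAlgClosed K] {x' y' : L} (h : (E⁄L).toAffine.Nonsingular x' y') {p : K[X]}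
    (hp : p ≠ 0) (hx : aeval x' p = 0) :
    ∃ P, constPoint E K L P = .some x' y' h := by
  obtain ⟨a, rfl⟩ := mem_range_of_aeval_eq_zero hp hx
  have he := (Affine.equation_iff' _ _).mp h.1
  rw [algebraMap_a₁ (K := K), algebraMap_a₂ (K := K),
    algebraMap_a₃ (K := K), algebraMap_a₄ (K := K), algebraMap_a₆ (K := K)] at he
  obtain ⟨b, rfl⟩ : ∃ b : K, algebraMap K L b = y' := by
    refine mem_range_of_aeval_eq_zero
      (p := C 1 * X ^ 2 + C ((E⁄K).a₁ * a + (E⁄K).a₃) * X +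
        C (-(a ^ 3 + (E⁄K).a₂ * a ^ 2 + (E⁄K).a₄ * a + (E⁄K).a₆))) ?_ ?_
    · intro h0
      have := degree_quadratic (one_ne_zero' K) (b := (E⁄K).a₁ * a + (E⁄K).a₃)
        (c := -(a ^ 3 + (E⁄K).a₂ * a ^ 2 + (E⁄K).a₄ * a + (E⁄K).a₆))
      rw [h0] at this
      simp at this
    · simp only [map_add, map_mul, map_pow, aeval_X, aeval_C, map_one, map_neg]
      linear_combination he
  exact ⟨.some a b (Affine.equation_iff_nonsingular.mp (equation_const.mp h.1)), rfl⟩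

/-- If the first coordinate of the translated generic point were algebraic over K, the translated
point would be constant, and so would the generic point. Hence it is transcendental and
`exists_lift` applies. -/
lemma exists_translate [IsAlgClosed K] (P : (E⁄K).toAffine.Point) : ∃ θ : L →ₐ[F] L,
    (∀ c, θ (algebraMap K L c) = algebraMap K L c) ∧
    Affine.Point.map (W' := E) θ G.pt = G.pt + constPoint E K L P := by
  rcases h : G.pt + constPoint E K L P with _ | ⟨x', y', h'⟩
  · have h2 : G.pt + constPoint E K L P = 0 := h
    refine absurd ?_ (G.pt_ne_const (-P))
    rw [map_neg]
    exact eq_neg_of_add_eq_zero_left h2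
  · obtain ⟨θ, h1, h2, h3⟩ := G.exists_lift (IsScalarTower.toAlgHom F K L) x' y' h'.1 (by
      intro p hp h0
      obtain ⟨Q, hQ⟩ := exists_const_eq h' hp h0
      refine G.pt_ne_const (Q - P) ?_
      rw [map_sub, hQ, ← h, add_sub_cancel_right])
    refine ⟨θ, h1, ?_⟩
    subst h2 h3
    rfl

variable [IsAlgClosed K]

/-- Translation by a constant point, as an endomorphism of the function field. -/
def translate (P : (E⁄K).toAffine.Point) : L →ₐ[F] L := (G.exists_translate P).choose

@[simp]
lemma translate_algebraMap (P : (E⁄K).toAffine.Point) (c : K) :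
    G.translate P (algebraMap K L c) = algebraMap K L c :=
  (G.exists_translate P).choose_spec.1 c

lemma map_translate_pt (P : (E⁄K).toAffine.Point) :
    Affine.Point.map (W' := E) (G.translate P) G.pt = G.pt + constPoint E K L P :=
  (G.exists_translate P).choose_spec.2

lemma map_translate_const (P Q : (E⁄K).toAffine.Point) :
    Affine.Point.map (W' := E) (G.translate P) (constPoint E K L Q) = constPoint E K L Q := by
  rcases Q with _ | ⟨a, b, h⟩
  · rfl
  · rw [constPoint, Affine.Point.map_some, Affine.Point.map_some, Affine.Point.some.injEq]
    exact ⟨G.translate_algebraMap P a, G.translate_algebraMap P b⟩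

/-- This turns identities between endomorphisms of the function field into identities in the group
of points. -/
lemma algHom_ext_pt {θ θ' : L →ₐ[F] L}
    (hK : ∀ c : K, θ (algebraMap K L c) = θ' (algebraMap K L c))
    (h : Affine.Point.map (W' := E) θ G.pt = Affine.Point.map (W' := E) θ' G.pt) : θ = θ' := by
  rw [pt, Affine.Point.map_some, Affine.Point.map_some, Affine.Point.some.injEq] at h
  exact G.algHom_ext hK h.1 h.2

lemma translate_comp (P Q : (E⁄K).toAffine.Point) :
    (G.translate P).comp (G.translate Q) = G.translate (P + Q) := by
  refine G.algHom_ext_pt (fun c => by simp) ?_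
  rw [← Affine.Point.map_map, map_translate_pt, map_add, map_translate_pt, map_translate_const,
    map_translate_pt, map_add, add_assoc]

lemma translate_translate (P Q : (E⁄K).toAffine.Point) (g : L) :
    G.translate P (G.translate Q g) = G.translate (P + Q) g :=
  AlgHom.congr_fun (G.translate_comp P Q) g

@[simp]
lemma translate_zero (g : L) : G.translate 0 g = g := by
  have : G.translate 0 = AlgHom.id F L := by
    refine G.algHom_ext_pt (fun c => by simp) ?_
    rw [map_translate_pt, map_zero, add_zero]
    rfl
  rw [this]
  rfl

lemma exists_conjugate (σ : K →ₐ[F] K) : ∃ θ : L →ₐ[F] L,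
    (∀ c, θ (algebraMap K L c) = algebraMap K L (σ c)) ∧ θ G.x = G.x ∧ θ G.y = G.y := by
  refine G.exists_lift ((IsScalarTower.toAlgHom F K L).comp σ) G.x G.y G.equation fun p hp h => ?_
  have h1 : p.map (σ : K →+* K) ≠ 0 := (Polynomial.map_ne_zero_iff σ.toRingHom.injective).mpr hp
  refine G.aeval_ne_zero h1 ?_
  rw [aeval_def, eval₂_map]
  exact h

/-- The action of an automorphism of the constants on the function field. -/
def conjugate (σ : K →ₐ[F] K) : L →ₐ[F] L := (G.exists_conjugate σ).choose

lemma conjugate_algebraMap (σ : K →ₐ[F] K) (c : K) :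
    G.conjugate σ (algebraMap K L c) = algebraMap K L (σ c) :=
  (G.exists_conjugate σ).choose_spec.1 c

lemma conjugate_x (σ : K →ₐ[F] K) : G.conjugate σ G.x = G.x :=
  (G.exists_conjugate σ).choose_spec.2.1

lemma conjugate_y (σ : K →ₐ[F] K) : G.conjugate σ G.y = G.y :=
  (G.exists_conjugate σ).choose_spec.2.2

/-- Conjugation fixes the generic point, so both composites send it to its translate by σ(P). -/
lemma conjugate_translate (σ : K →ₐ[F] K) (P : (E⁄K).toAffine.Point) (g : L) :
    G.conjugate σ (G.translate P g) =
      G.translate (Affine.Point.map (W' := E) σ P) (G.conjugate σ g) := by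
  have hpt : Affine.Point.map (W' := E) (G.conjugate σ) G.pt = G.pt := by
    rw [pt, Affine.Point.map_some, Affine.Point.some.injEq]
    exact ⟨G.conjugate_x σ, G.conjugate_y σ⟩
  have hconst : Affine.Point.map (W' := E) (G.conjugate σ) (constPoint E K L P) =
      constPoint E K L (Affine.Point.map (W' := E) σ P) := by
    rcases P with _ | ⟨a, b, h⟩
    · rfl
    · rw [constPoint, Affine.Point.map_some, Affine.Point.map_some, Affine.Point.map_some,
        Affine.Point.map_some, Affine.Point.some.injEq]
      exact ⟨G.conjugate_algebraMap σ a, G.conjugate_algebraMap σ b⟩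
  have : (G.conjugate σ).comp (G.translate P) =
      (G.translate (Affine.Point.map (W' := E) σ P)).comp (G.conjugate σ) := by
    refine G.algHom_ext_pt (fun c => by simp [conjugate_algebraMap]) ?_
    rw [← Affine.Point.map_map, ← Affine.Point.map_map, map_translate_pt, map_add, hpt, hconst,
      map_translate_pt]
  exact AlgHom.congr_fun this g

/-- On p(x) + q(x)y the value depends only on degrees, which an injective change of coefficients
preserves. -/
lemma v_conjugate (σ : K →ₐ[F] K) (g : L) : G.v (G.conjugate σ g) = G.v g := by
  have hp : ∀ p : K[X], G.conjugate σ (aeval G.x p) = aeval G.x (p.map (σ : K →+* K)) := by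
    intro p
    induction p using Polynomial.induction_on' with
    | add p q hp hq => simp only [map_add, hp, hq, Polynomial.map_add]
    | monomial n a => simp [aeval_monomial, conjugate_algebraMap, conjugate_x]
  have hv : ∀ p : K[X], G.v (aeval G.x (p.map (σ : K →+* K))) = G.v (aeval G.x p) := by
    intro p
    by_cases h0 : p = 0
    · simp [h0]
    have h1 : p.map (σ : K →+* K) ≠ 0 := (Polynomial.map_ne_zero_iff σ.toRingHom.injective).mpr h0
    rw [G.v_aeval h0, G.v_aeval h1, natDegree_map_eq_of_injective (f := (σ : K →+* K)) σ.toRingHom.injective]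
  obtain ⟨p, q, r, hr, h⟩ := G.exists_eq g
  have h1 := congrArg (G.conjugate σ) h
  simp only [map_add, map_mul, hp, conjugate_y] at h1
  have h2 := congrArg G.v h
  have h3 := congrArg G.v h1
  rw [v_form, map_mul, map_mul] at h2 h3
  rw [hv, hv, hv, ← h2] at h3
  exact mul_right_cancel₀ ((Valuation.ne_zero_iff _).mpr (G.aeval_ne_zero hr)) h3

end WeierstrassCurve.GenericPoint

end

/-! ### Local behaviour at constant points; functions without poles -/

noncomputable section

open Polynomial WithZero

lemma WeierstrassCurve.exists_nonsingular_of_isAlgClosed {K : Type*} [Field K] [IsAlgClosed K]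
    (W : WeierstrassCurve K) [W.IsElliptic] (a : K) :
    ∃ b, W.toAffine.Nonsingular a b := by
  obtain ⟨b, hb⟩ := IsAlgClosed.exists_root (C 1 * X ^ 2 + C (W.a₁ * a + W.a₃) * X +
    C (-(a ^ 3 + W.a₂ * a ^ 2 + W.a₄ * a + W.a₆))) (by
      rw [degree_quadratic one_ne_zero]; norm_num)
  refine ⟨b, Affine.equation_iff_nonsingular.mp ((Affine.equation_iff' _ _).mpr ?_)⟩
  simp only [IsRoot, eval_add, eval_mul, eval_pow, eval_C, eval_X] at hb
  linear_combination hb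

namespace WeierstrassCurve.GenericPoint

variable {F K L : Type*} [Field F] [Field K] [Field L] [Algebra F K] [Algebra F L] [Algebra K L]
  {E : WeierstrassCurve F} (G : GenericPoint E K L) [E.IsElliptic] [IsScalarTower F K L]
  [IsAlgClosed K]

lemma equation_gen : G.y ^ 2 + algebraMap K L (E⁄K).a₁ * G.x * G.y + algebraMap K L (E⁄K).a₃ * G.y =
    G.x ^ 3 + algebraMap K L (E⁄K).a₂ * G.x ^ 2 + algebraMap K L (E⁄K).a₄ * G.x +
      algebraMap K L (E⁄K).a₆ := by
  have h := (Affine.equation_iff _ _).mp G.equation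
  rwa [algebraMap_a₁ (K := K), algebraMap_a₂ (K := K), algebraMap_a₃ (K := K),
    algebraMap_a₄ (K := K), algebraMap_a₆ (K := K)] at h

/-- The slope of the line through the generic point and a constant point. -/
def slope (a b : K) : L := (G.y - algebraMap K L b) / (G.x - algebraMap K L a)

lemma x_sub_ne_zero (a : K) : G.x - algebraMap K L a ≠ 0 := sub_ne_zero.mpr (G.x_ne a)

lemma slope_mul (a b : K) : G.slope a b * (G.x - algebraMap K L a) = G.y - algebraMap K L b :=
  div_mul_cancel₀ _ (G.x_sub_ne_zero a)

section Affine

variable {a b : K} (h : (E⁄K).toAffine.Nonsingular a b)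

lemma nonsingular_const {a b : K} (h : (E⁄K).toAffine.Nonsingular a b) :
    (E⁄L).toAffine.Nonsingular (algebraMap K L a) (algebraMap K L b) :=
  Affine.equation_iff_nonsingular.mp (equation_const.mpr h.1)

lemma translate_some : G.translate (.some a b h) G.x = G.slope a b ^ 2 +
      algebraMap K L (E⁄K).a₁ * G.slope a b - algebraMap K L (E⁄K).a₂ - G.x - algebraMap K L a ∧
    G.translate (.some a b h) G.y - algebraMap K L b =
      -(G.slope a b + algebraMap K L (E⁄K).a₁) *
        (G.translate (.some a b h) G.x - algebraMap K L a) -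
      algebraMap K L (2 * b + (E⁄K).a₁ * a + (E⁄K).a₃) := by
  have h1 := G.map_translate_pt (.some a b h)
  have h3 := Affine.Point.add_of_X_ne (h₁ := G.nonsingular) (h₂ := nonsingular_const (L := L) h)
    (G.x_ne a)
  replace h1 := h1.trans h3
  rw [pt, Affine.Point.map_some, Affine.Point.some.injEq, Affine.slope_of_X_ne (G.x_ne a)] at h1
  obtain ⟨hx, hy⟩ := h1
  have hs : (G.y - algebraMap K L b) / (G.x - algebraMap K L a) = G.slope a b := rfl
  rw [hs] at hx hy
  have h2 := G.slope_mul a b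
  rw [Affine.addY, ← hx, Affine.negAddY, ← hx, Affine.negY] at hy
  rw [Affine.addX] at hx
  simp only [algebraMap_a₁ (K := K) (L := L), algebraMap_a₂ (K := K) (L := L),
    algebraMap_a₃ (K := K) (L := L)] at hx hy
  refine ⟨hx, ?_⟩
  rw [hy]
  simp only [map_add, map_mul, map_ofNat]
  linear_combination h2

/-- The right-hand side is the tangent line at (a, b). Its pole order at O is 3, or 2 when the
tangent is vertical, against 4 for (x - a)²; this gives the order of vanishing of x - a at the
point. -/
lemma translate_x_sub : (G.translate (.some a b h) G.x - algebraMap K L a) *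
    (G.x - algebraMap K L a) ^ 2 =
    -algebraMap K L (2 * b + (E⁄K).a₁ * a + (E⁄K).a₃) * G.y +
    algebraMap K L (3 * a ^ 2 + 2 * (E⁄K).a₂ * a + (E⁄K).a₄ - (E⁄K).a₁ * b) * G.x +
    algebraMap K L ((E⁄K).a₆ + b ^ 2 + (E⁄K).a₁ * a * b - 2 * a ^ 3 - (E⁄K).a₂ * a ^ 2) := by
  have h2 := G.slope_mul a b
  have h3 := G.equation_gen
  rw [(G.translate_some h).1]
  simp only [map_add, map_sub, map_mul, map_pow, map_ofNat]
  generalize G.slope a b = s at *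
  generalize algebraMap K L (E⁄K).a₁ = a1 at *
  generalize algebraMap K L (E⁄K).a₂ = a2 at *
  generalize algebraMap K L (E⁄K).a₃ = a3 at *
  generalize algebraMap K L (E⁄K).a₄ = a4 at *
  generalize algebraMap K L (E⁄K).a₆ = a6 at *
  generalize algebraMap K L a = A at *
  generalize algebraMap K L b = B at *
  linear_combination h3 + (s * (G.x - A) + (G.y - B) + a1 * (G.x - A)) * h2

/-- Only the degree bounds matter: the numerator has a pole of order at most 5 at O and (x - a)³ one
of order 6, so y - b vanishes at the point. -/
lemma exists_translate_y_sub_eq : ∃ p q : K[X], p.natDegree ≤ 2 ∧ q.natDegree ≤ 1 ∧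
    (G.translate (.some a b h) G.y - algebraMap K L b) * (G.x - algebraMap K L a) ^ 3 =
      aeval G.x p + aeval G.x q * G.y := by
  obtain ⟨ψ, hψ⟩ : ∃ ψ, ψ = 2 * b + (E⁄K).a₁ * a + (E⁄K).a₃ := ⟨_, rfl⟩
  obtain ⟨α, hα⟩ : ∃ α, α = 3 * a ^ 2 + 2 * (E⁄K).a₂ * a + (E⁄K).a₄ - (E⁄K).a₁ * b := ⟨_, rfl⟩
  obtain ⟨β, hβ⟩ : ∃ β, β = (E⁄K).a₆ + b ^ 2 + (E⁄K).a₁ * a * b - 2 * a ^ 3 - (E⁄K).a₂ * a ^ 2 :=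
    ⟨_, rfl⟩
  refine ⟨C (ψ * (E⁄K).a₂ - (E⁄K).a₁ * α + 3 * ψ * a) * X ^ 2 +
    C (ψ * (E⁄K).a₄ - (E⁄K).a₁ * β + (b + (E⁄K).a₁ * a) * α - 3 * ψ * a ^ 2) * X +
    C (ψ * (E⁄K).a₆ + (b + (E⁄K).a₁ * a) * β + ψ * a ^ 3),
    C (-α) * X + C (-ψ * (E⁄K).a₃ - β - (b + (E⁄K).a₁ * a) * ψ), natDegree_quadratic_le,
    natDegree_linear_le, ?_⟩
  have h1 := G.translate_x_sub h
  have h2 := G.slope_mul a b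
  have h3 := G.equation_gen
  rw [(G.translate_some h).2]
  rw [← hψ, ← hα, ← hβ] at h1
  rw [← hψ]
  simp only [map_add, map_sub, map_mul, map_pow, map_ofNat, map_neg, aeval_X, aeval_C] at h1 ⊢
  generalize G.translate (.some a b h) G.x = X' at *
  generalize G.slope a b = s at *
  generalize algebraMap K L (E⁄K).a₁ = a1 at *
  generalize algebraMap K L (E⁄K).a₂ = a2 at *
  generalize algebraMap K L (E⁄K).a₃ = a3 at *
  generalize algebraMap K L (E⁄K).a₄ = a4 at *
  generalize algebraMap K L (E⁄K).a₆ = a6 at *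
  generalize algebraMap K L a = A at *
  generalize algebraMap K L b = B at *
  generalize algebraMap K L ψ = ψ at *
  generalize algebraMap K L α = α at *
  generalize algebraMap K L β = β at *
  linear_combination (-(s + a1) * (G.x - A)) * h1 + ψ * h3 - (-ψ * G.y + α * G.x + β) * h2

lemma v_le_of_natDegree_le {p : K[X]} {n : ℕ} (hp : p.natDegree ≤ n) :
    G.v (aeval G.x p) ≤ exp (2 * n : ℤ) := by
  by_cases h0 : p = 0
  · simp [h0]
  · rw [G.v_aeval h0, exp_le_exp]
    omega

lemma v_linear {α β γ : K} (hα : α ≠ 0) :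
    G.v (algebraMap K L α * G.y + algebraMap K L β * G.x + algebraMap K L γ) = exp 3 := by
  have h1 := G.v_form (p := C β * X + C γ) (q := C α)
  have h2 := G.v_aeval_mul_y (C_ne_zero.mpr hα)
  rw [natDegree_C] at h2
  rw [h2, max_eq_right] at h1
  · simp only [map_add, map_mul, aeval_X, aeval_C] at h1
    refine (congrArg G.v ?_).trans (h1.trans (by norm_num))
    ring
  · refine (G.v_le_of_natDegree_le natDegree_linear_le).trans ?_
    rw [exp_le_exp]
    norm_num

lemma v_translate_x_sub_of_ne (hψ : 2 * b + (E⁄K).a₁ * a + (E⁄K).a₃ ≠ 0) :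
    G.v (G.translate (.some a b h) G.x - algebraMap K L a) = exp (-1) := by
  have h1 := congrArg G.v (G.translate_x_sub h)
  rw [← map_neg, G.v_linear (neg_ne_zero.mpr hψ), map_mul, map_pow, G.v_x_sub] at h1
  refine mul_right_cancel₀ (b := exp 2 ^ 2) (pow_ne_zero _ exp_ne_zero) (h1.trans ?_)
  rw [← exp_nsmul, ← exp_add]
  rfl

lemma v_translate_x_sub_of_eq (hψ : 2 * b + (E⁄K).a₁ * a + (E⁄K).a₃ = 0) :
    G.v (G.translate (.some a b h) G.x - algebraMap K L a) = exp (-2) := by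
  have h1 := congrArg G.v (G.translate_x_sub h)
  -- The derivative in Y vanishes, so nonsingularity forces the derivative in X not to.
  have hα : 3 * a ^ 2 + 2 * (E⁄K).a₂ * a + (E⁄K).a₄ - (E⁄K).a₁ * b ≠ 0 := by
    rcases ((Affine.nonsingular_iff' _ _).mp h).2 with h | h
    · contrapose! h
      linear_combination -h
    · exact absurd hψ h
  rw [hψ, map_zero, neg_zero, zero_mul, zero_add] at h1
  have h2 := G.v_aeval (p := C (3 * a ^ 2 + 2 * (E⁄K).a₂ * a + (E⁄K).a₄ - (E⁄K).a₁ * b) * X + 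
    C ((E⁄K).a₆ + b ^ 2 + (E⁄K).a₁ * a * b - 2 * a ^ 3 - (E⁄K).a₂ * a ^ 2)) (fun h0 => by
      have := degree_linear hα (b := (E⁄K).a₆ + b ^ 2 + (E⁄K).a₁ * a * b - 2 * a ^ 3 - (E⁄K).a₂ * a ^ 2)
      rw [h0] at this
      simp at this)
  rw [natDegree_linear hα, map_add, map_mul, aeval_X, aeval_C, aeval_C] at h2
  rw [h2, map_mul, map_pow, G.v_x_sub] at h1
  refine mul_right_cancel₀ (b := exp 2 ^ 2) (pow_ne_zero _ exp_ne_zero) (h1.trans ?_)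
  rw [← exp_nsmul, ← exp_add]
  rfl

lemma v_slope_add (c : K) : G.v (G.slope a b + algebraMap K L c) = exp 1 := by
  have h1 : (G.slope a b + algebraMap K L c) * (G.x - algebraMap K L a) =
      algebraMap K L 1 * G.y + algebraMap K L c * G.x + algebraMap K L (- b - c * a) := by
    simp only [map_sub, map_neg, map_one, map_mul]
    linear_combination G.slope_mul a b
  have h2 := congrArg G.v h1
  rw [G.v_linear one_ne_zero, map_mul, G.v_x_sub] at h2
  refine mul_right_cancel₀ (b := exp 2) exp_ne_zero (h2.trans ?_)
  rw [← exp_add]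
  rfl

lemma v_translate_y_sub_of_eq (hψ : 2 * b + (E⁄K).a₁ * a + (E⁄K).a₃ = 0) :
    G.v (G.translate (.some a b h) G.y - algebraMap K L b) = exp (-1) := by
  rw [(G.translate_some h).2, hψ, map_zero, sub_zero, map_mul, Valuation.map_neg, G.v_slope_add,
    G.v_translate_x_sub_of_eq h hψ, ← exp_add]
  rfl

lemma v_translate_y_sub_lt : G.v (G.translate (.some a b h) G.y - algebraMap K L b) < 1 := by
  obtain ⟨p, q, hp, hq, hpq⟩ := G.exists_translate_y_sub_eq h
  have h1 := congrArg G.v hpq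
  rw [map_mul, map_pow, G.v_x_sub, G.v_form] at h1
  have h2 : max (G.v (aeval G.x p)) (G.v (aeval G.x q * G.y)) ≤ exp 5 := by
    refine max_le ((G.v_le_of_natDegree_le hp).trans ?_) ?_
    · rw [exp_le_exp]; norm_num
    · rw [map_mul, G.v_y]
      refine (mul_le_mul_left (G.v_le_of_natDegree_le hq) _).trans ?_
      rw [← exp_add, exp_le_exp]
      norm_num
  rw [← h1] at h2
  by_contra! h3
  have h4 := (mul_le_mul_left h3 (exp 2 ^ 3)).trans h2
  rw [one_mul, ← exp_nsmul, exp_le_exp] at h4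
  norm_num at h4

lemma v_translate_x_sub_lt : G.v (G.translate (.some a b h) G.x - algebraMap K L a) < 1 := by
  by_cases hψ : 2 * b + (E⁄K).a₁ * a + (E⁄K).a₃ = 0
  · rw [G.v_translate_x_sub_of_eq h hψ, ← exp_zero, exp_lt_exp]
    norm_num
  · rw [G.v_translate_x_sub_of_ne h hψ, ← exp_zero, exp_lt_exp]
    norm_num

lemma v_le_one_of_sub_lt {z : L} {c : K} (hz : G.v (z - algebraMap K L c) < 1) : G.v z ≤ 1 := by
  rw [← sub_add_cancel z (algebraMap K L c)]
  exact (G.v.map_add _ _).trans (max_le hz.le (G.v_algebraMap_le c))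

lemma v_aeval_le_one {z : L} (hz : G.v z ≤ 1) (p : K[X]) : G.v (aeval z p) ≤ 1 := by
  induction p using Polynomial.induction_on' with
  | add p q hp hq =>
    rw [map_add]
    exact (G.v.map_add _ _).trans (max_le hp hq)
  | monomial n c =>
    rw [aeval_monomial, map_mul, map_pow]
    exact mul_le_one' (G.v_algebraMap_le c) (pow_le_one' hz n)

lemma translate_aeval (P : (E⁄K).toAffine.Point) (p : K[X]) :
    G.translate P (aeval G.x p) = aeval (G.translate P G.x) p := by
  induction p using Polynomial.induction_on' with
  | add p q hp hq => simp only [map_add, hp, hq]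
  | monomial n c => simp [aeval_monomial]

lemma v_translate_aeval_sub_lt (p : K[X]) :
    G.v (aeval (G.translate (.some a b h) G.x) p - algebraMap K L (p.eval a)) < 1 := by
  have h1 := G.v_translate_x_sub_lt h
  have h2 := congrArg (aeval (G.translate (.some a b h) G.x)) (mul_divByMonic_eq_iff_isRoot.mpr
    (show (p - C (p.eval a)).IsRoot a by simp))
  rw [map_mul, map_sub, map_sub, aeval_X, aeval_C, aeval_C] at h2
  rw [← h2, map_mul]
  exact (mul_le_of_le_one_right' (G.v_aeval_le_one (G.v_le_one_of_sub_lt h1) _)).trans_lt h1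

lemma v_translate_form_sub_lt (p q : K[X]) :
    G.v (G.translate (.some a b h) (aeval G.x p + aeval G.x q * G.y) -
      algebraMap K L (p.eval a + q.eval a * b)) < 1 := by
  have h1 := G.v_translate_y_sub_lt h
  have h2 := G.v_translate_aeval_sub_lt h p
  have h3 := G.v_translate_aeval_sub_lt h q
  have h4 : G.translate (.some a b h) (aeval G.x p + aeval G.x q * G.y) -
      algebraMap K L (p.eval a + q.eval a * b) =
      (aeval (G.translate (.some a b h) G.x) p - algebraMap K L (p.eval a)) +
      ((aeval (G.translate (.some a b h) G.x) q - algebraMap K L (q.eval a)) *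
        G.translate (.some a b h) G.y + algebraMap K L (q.eval a) *
        (G.translate (.some a b h) G.y - algebraMap K L b)) := by
    simp only [map_add, map_mul, translate_aeval]
    ring
  rw [h4]
  refine G.v.map_add_lt h2 (G.v.map_add_lt ?_ ?_)
  · rw [map_mul]
    exact (mul_le_of_le_one_right' (G.v_le_one_of_sub_lt h1)).trans_lt h3
  · rw [map_mul]
    exact (mul_le_of_le_one_left' (G.v_algebraMap_le _)).trans_lt h1

lemma v_translate_form_le_one (p q : K[X]) :
    G.v (G.translate (.some a b h) (aeval G.x p + aeval G.x q * G.y)) ≤ 1 :=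
  G.v_le_one_of_sub_lt (G.v_translate_form_sub_lt h p q)

/-- Composed with translation by a point, the valuation at O becomes the valuation at that point. A
regular function is congruent there to its value, and nonzero constants are units. -/
lemma v_translate_form_lt_one_iff (p q : K[X]) :
    G.v (G.translate (.some a b h) (aeval G.x p + aeval G.x q * G.y)) < 1 ↔
      p.eval a + q.eval a * b = 0 := by
  have h1 := G.v_translate_form_sub_lt h p q
  constructor
  · intro h2
    by_contra h0
    have h3 := G.v.map_sub_lt h2 h1
    rw [sub_sub_cancel, G.v_algebraMap _ h0] at h3
    exact lt_irrefl _ h3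
  · intro h0
    rwa [h0, map_zero, sub_zero] at h1

end Affine

/-- A function without zeros of the denominator can be simplified. -/
lemma exists_form_of_regular {g : L} (hg : ∀ P, P ≠ 0 → G.v (G.translate P g) ≤ 1) :
    ∃ p q : K[X], g = aeval G.x p + aeval G.x q * G.y := by
  obtain ⟨p, q, r, hr, h⟩ := G.exists_eq g
  induction hn : r.natDegree generalizing p q r with
  | zero =>
    obtain ⟨c, rfl⟩ := natDegree_eq_zero.mp hn
    have hc : algebraMap K L c ≠ 0 := by simpa using hr
    refine ⟨C c⁻¹ * p, C c⁻¹ * q, mul_right_cancel₀ hc ?_⟩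
    rw [aeval_C] at h
    rw [h, map_mul, map_mul, aeval_C, map_inv₀]
    field_simp
  | succ n ih =>
    obtain ⟨a, ha⟩ := IsAlgClosed.exists_root r (by
      rw [degree_eq_natDegree hr, hn]; exact Nat.cast_ne_zero.mpr (Nat.succ_ne_zero n))
    obtain ⟨r', rfl⟩ := dvd_iff_isRoot.mpr ha
    have hr' := right_ne_zero_of_mul hr
    obtain ⟨b, hb⟩ := (E⁄K).exists_nonsingular_of_isAlgClosed a
    -- At each point above a root a of the denominator, the numerator vanishes at least to the order
    -- of x - a; the factor x - a is then cancelled from both.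
    have key : ∀ b (hb : (E⁄K).toAffine.Nonsingular a b),
        G.v (G.translate (.some a b hb) (aeval G.x p + aeval G.x q * G.y)) ≤
          G.v (G.translate (.some a b hb) G.x - algebraMap K L a) := by
      intro b hb
      rw [← h, map_mul, map_mul, translate_aeval, map_mul, map_mul, map_sub, aeval_X, aeval_C]
      refine (mul_le_of_le_one_left' (hg _ (Affine.Point.some_ne_zero _))).trans
        (mul_le_of_le_one_right' ?_)
      exact G.v_aeval_le_one (G.v_le_one_of_sub_lt (G.v_translate_x_sub_lt hb)) _
    have hpb := (G.v_translate_form_lt_one_iff hb p q).mp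
      ((key b hb).trans_lt (G.v_translate_x_sub_lt hb))
    -- At a point of order two, x - a vanishes doubly but y - b only simply, so y cannot occur to
    -- first order. Otherwise the values at (a, b) and at its negative both vanish, and their
    -- difference is q(a)(2b + a₁a + a₃).
    have hq : q.eval a = 0 := by
      by_cases hψ : 2 * b + (E⁄K).a₁ * a + (E⁄K).a₃ = 0
      · by_contra hq
        have h1 := key b hb
        have h2 : G.translate (.some a b hb) (aeval G.x p + aeval G.x q * G.y) =
            aeval (G.translate (.some a b hb) G.x) (p - C (p.eval a)) +
            aeval (G.translate (.some a b hb) G.x) (q - C (q.eval a)) *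
              G.translate (.some a b hb) G.y +
            algebraMap K L (q.eval a) * (G.translate (.some a b hb) G.y - algebraMap K L b) := by
          have h3 := congrArg (algebraMap K L) hpb
          simp only [map_add, map_mul, map_zero] at h3
          simp only [map_add, map_mul, map_sub, translate_aeval, aeval_C]
          linear_combination h3
        have h4 : ∀ s : K[X], G.v (aeval (G.translate (.some a b hb) G.x) (s - C (s.eval a))) ≤
            exp (-2) := by
          intro s
          have h2 := congrArg (aeval (G.translate (.some a b hb) G.x))
            (mul_divByMonic_eq_iff_isRoot.mpr (show (s - C (s.eval a)).IsRoot a by simp))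
          rw [map_mul, map_sub, aeval_X, aeval_C] at h2
          rw [← h2, map_mul, G.v_translate_x_sub_of_eq hb hψ]
          exact mul_le_of_le_one_right'
            (G.v_aeval_le_one (G.v_le_one_of_sub_lt (G.v_translate_x_sub_lt hb)) _)
        have h5 : G.v (algebraMap K L (q.eval a) *
            (G.translate (.some a b hb) G.y - algebraMap K L b)) = exp (-1) := by
          rw [map_mul, G.v_algebraMap _ hq, one_mul, G.v_translate_y_sub_of_eq hb hψ]
        rw [G.v_translate_x_sub_of_eq hb hψ, h2, Valuation.map_add_eq_of_lt_right, h5,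
          exp_le_exp] at h1
        · norm_num at h1
        · rw [h5]
          refine lt_of_le_of_lt ((G.v.map_add _ _).trans (max_le (h4 p) ?_)) (exp_lt_exp.mpr
            (show (-2 : ℤ) < -1 by norm_num))
          rw [map_mul]
          exact (mul_le_of_le_one_right' (G.v_le_one_of_sub_lt (G.v_translate_y_sub_lt hb))).trans
            (h4 q)
      · have hb' := (Affine.nonsingular_neg a b).mpr hb
        have hpb' := (G.v_translate_form_lt_one_iff hb' p q).mp
          ((key _ hb').trans_lt (G.v_translate_x_sub_lt hb'))
        rw [Affine.negY] at hpb'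
        refine (mul_eq_zero.mp ?_).resolve_right hψ
        linear_combination hpb - hpb'
    have hp : p.eval a = 0 := by rw [hq] at hpb; simpa using hpb
    obtain ⟨p', rfl⟩ := dvd_iff_isRoot.mpr hp
    obtain ⟨q', rfl⟩ := dvd_iff_isRoot.mpr hq
    refine ih p' q' r' hr' (mul_left_cancel₀ (G.x_sub_ne_zero a) ?_) ?_
    · simp only [map_mul, map_sub, aeval_X, aeval_C] at h
      linear_combination h
    · rw [natDegree_mul (X_sub_C_ne_zero a) hr', natDegree_X_sub_C] at hn
      omega

/-- A function without poles is constant. -/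
lemma exists_eq_algebraMap_of_regular {g : L} (hg : ∀ P, G.v (G.translate P g) ≤ 1) :
    ∃ c : K, g = algebraMap K L c := by
  obtain ⟨p, q, rfl⟩ := G.exists_form_of_regular fun P _ => hg P
  have h0 := hg 0
  rw [translate_zero] at h0
  obtain ⟨c, rfl, rfl⟩ := G.eq_C_of_v_form_le_one h0
  exact ⟨c, by simp⟩

end WeierstrassCurve.GenericPoint

end

/-! ### Divisors of functions and principal divisors -/

noncomputable section

open Polynomial WithZero

namespace WeierstrassCurve.GenericPoint

variable {F K L : Type*} [Field F] [Field K] [Field L] [Algebra F K] [Algebra F L] [Algebra K L]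
  {E : WeierstrassCurve F} (G : GenericPoint E K L) [E.IsElliptic] [IsScalarTower F K L]
  [IsAlgClosed K]

/-- The divisor of a function, as an integral function on the constant points. -/
def ord (g : L) (P : (E⁄K).toAffine.Point) : ℤ := -log (G.v (G.translate P g))

lemma translate_ne_zero {g : L} (hg : g ≠ 0) (P : (E⁄K).toAffine.Point) : G.translate P g ≠ 0 :=
  (map_ne_zero_iff _ (G.translate P).toRingHom.injective).mpr hg

lemma v_translate_ne_zero {g : L} (hg : g ≠ 0) (P : (E⁄K).toAffine.Point) :
    G.v (G.translate P g) ≠ 0 :=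
  (Valuation.ne_zero_iff _).mpr (G.translate_ne_zero hg P)

lemma v_eq_exp_ord {g : L} (hg : g ≠ 0) (P : (E⁄K).toAffine.Point) :
    G.v (G.translate P g) = exp (-G.ord g P) := by
  rw [ord, neg_neg, exp_log (G.v_translate_ne_zero hg P)]

lemma ord_eq_of_v_eq {g : L} {P : (E⁄K).toAffine.Point} {m : ℤ}
    (h : G.v (G.translate P g) = exp (-m)) : G.ord g P = m := by
  rw [ord, h, log_exp, neg_neg]

lemma ord_mul {f g : L} (hf : f ≠ 0) (hg : g ≠ 0) : G.ord (f * g) = G.ord f + G.ord g := by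
  ext P
  rw [Pi.add_apply, ord, map_mul, map_mul, log_mul (G.v_translate_ne_zero hf P)
    (G.v_translate_ne_zero hg P), ord, ord]
  ring

lemma ord_inv (g : L) : G.ord g⁻¹ = -G.ord g := by
  ext P
  rw [Pi.neg_apply, ord, map_inv₀, map_inv₀, log_inv, ord]

lemma ord_one : G.ord 1 = 0 := by
  ext P
  rw [ord, map_one, map_one, log_one]
  rfl

lemma ord_prod {ι : Type*} (s : Finset ι) (f : ι → L) (hf : ∀ i ∈ s, f i ≠ 0) :
    G.ord (∏ i ∈ s, f i) = ∑ i ∈ s, G.ord (f i) := by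
  induction s using Finset.induction_on with
  | empty => simpa using G.ord_one
  | insert a s ha ih =>
    have h1 : ∀ i ∈ s, f i ≠ 0 := fun i hi => hf i (Finset.mem_insert_of_mem hi)
    rw [Finset.prod_insert ha, Finset.sum_insert ha, ord_mul, ih h1]
    · exact hf a (Finset.mem_insert_self a s)
    · exact Finset.prod_ne_zero_iff.mpr h1

lemma ord_translate (g : L) (P Q : (E⁄K).toAffine.Point) :
    G.ord (G.translate Q g) P = G.ord g (P + Q) := by
  rw [ord, translate_translate, ord]

lemma ord_conjugate (σ : K →ₐ[F] K) (g : L) (P : (E⁄K).toAffine.Point) :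
    G.ord (G.conjugate σ g) (Affine.Point.map (W' := E) σ P) = G.ord g P := by
  rw [ord, ← conjugate_translate, v_conjugate, ord]

lemma exists_eq_algebraMap {g : L} (h0 : g ≠ 0) (hg : 0 ≤ G.ord g) :
    ∃ c : K, c ≠ 0 ∧ g = algebraMap K L c := by
  obtain ⟨c, rfl⟩ := G.exists_eq_algebraMap_of_regular (g := g) fun P => by
    rw [G.v_eq_exp_ord h0, ← exp_zero, exp_le_exp]
    exact neg_nonpos.mpr (hg P)
  exact ⟨c, by simpa using h0, rfl⟩

/-- The quotient has no poles, hence is constant. An inequality of divisors suffices, so orders of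
zeros need only be bounded below. -/
lemma exists_eq_algebraMap_mul {f g : L} (hf : f ≠ 0) (hg : g ≠ 0) (h : G.ord g ≤ G.ord f) :
    ∃ c : K, c ≠ 0 ∧ f = algebraMap K L c * g := by
  obtain ⟨c, hc, h1⟩ := G.exists_eq_algebraMap (mul_ne_zero hf (inv_ne_zero hg)) (by
    rw [ord_mul _ hf (inv_ne_zero hg), ord_inv, ← sub_eq_add_neg]
    exact sub_nonneg.mpr h)
  refine ⟨c, hc, ?_⟩
  rw [← h1, inv_mul_cancel_right₀ hg]

/-- The divisor of a point. -/
def delta {A : Type*} (P Q : A) : ℤ := if Q = P then 1 else 0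

lemma delta_congr {A : Type*} {P Q P' Q' : A} (h : Q = P ↔ Q' = P') : delta P Q = delta P' Q' := by
  simp only [delta, h]

lemma delta_add {A : Type*} [AddGroup A] (P Q R : A) : delta P (Q + R) = delta (P - R) Q := by
  simp only [delta, eq_sub_iff_add_eq]

/-- The function `x - x(P)`, with divisor `(P) + (-P) - 2(O)`. -/
def xSub : (E⁄K).toAffine.Point → L
  | .zero => 1
  | .some a _ _ => G.x - algebraMap K L a

lemma xSub_ne_zero (P : (E⁄K).toAffine.Point) : G.xSub P ≠ 0 := by
  rcases P with _ | ⟨a, b, h⟩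
  · exact one_ne_zero
  · exact G.x_sub_ne_zero a

lemma neg_eq_self_iff {a b : K} (h : (E⁄K).toAffine.Nonsingular a b) :
    -(Affine.Point.some a b h) = .some a b h ↔ 2 * b + (E⁄K).a₁ * a + (E⁄K).a₃ = 0 := by
  rw [Affine.Point.neg_some, Affine.Point.some.injEq, Affine.negY]
  constructor
  · rintro ⟨-, h⟩
    linear_combination -h
  · intro h
    exact ⟨rfl, by linear_combination -h⟩

lemma v_translate_x_sub_of_ne_x {a b c : K} (h : (E⁄K).toAffine.Nonsingular a b) (hc : a ≠ c) :
    G.v (G.translate (.some a b h) (G.x - algebraMap K L c)) = 1 := by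
  have h1 := G.v_translate_form_le_one h (X - C c) 0
  have h2 := G.v_translate_form_lt_one_iff h (X - C c) 0
  rw [map_zero, zero_mul, add_zero, map_sub, aeval_X, aeval_C] at h1 h2
  simp only [eval_sub, eval_X, eval_C, eval_zero, zero_mul, add_zero, sub_eq_zero, hc, iff_false,
    not_lt] at h2
  exact le_antisymm h1 h2

lemma ord_xSub (P Q : (E⁄K).toAffine.Point) :
    G.ord (G.xSub P) Q = delta P Q + delta (-P) Q - 2 * delta 0 Q := by
  rcases P with _ | ⟨a, b, h⟩
  · rw [xSub, ord_one, ← Affine.Point.zero_def, neg_zero]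
    simp only [Pi.zero_apply]
    ring
  · rcases Q with _ | ⟨c, d, h'⟩
    · rw [← Affine.Point.zero_def, delta, delta, delta, if_neg, if_neg, if_pos rfl]
      · refine G.ord_eq_of_v_eq ?_
        rw [translate_zero, xSub, v_x_sub]
        rfl
      · rw [Affine.Point.neg_some]
        exact (Affine.Point.some_ne_zero _).symm
      · exact (Affine.Point.some_ne_zero _).symm
    · rw [delta, delta, delta, if_neg (Affine.Point.some_ne_zero h')]
      by_cases hac : c = a
      · subst hac
        have hx := G.v_translate_x_sub_of_eq h'
        have hx' := G.v_translate_x_sub_of_ne h'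
        have hX := (Affine.Point.X_eq_iff (h₁ := h') (h₂ := h)).mp rfl
        by_cases hψ : 2 * d + (E⁄K).a₁ * c + (E⁄K).a₃ = 0
        · have hneg := (neg_eq_self_iff h').mpr hψ
          have he : Affine.Point.some c d h' = Affine.Point.some c b h := by
            rcases hX with h1 | h1
            · exact h1
            · rw [← hneg, h1, neg_neg]
          rw [← he, hneg, if_pos rfl]
          refine G.ord_eq_of_v_eq ?_
          rw [xSub, map_sub, translate_algebraMap, hx hψ]
          rfl
        · have hneg := fun h1 => hψ ((neg_eq_self_iff h').mp h1)
          have h1 : G.ord (G.xSub (.some c b h)) (.some c d h') = 1 := by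
            refine G.ord_eq_of_v_eq ?_
            rw [xSub, map_sub, translate_algebraMap, hx' hψ]
          rw [h1]
          rcases hX with h2 | h2
          · rw [if_pos h2, if_neg]
            · rfl
            · rw [← h2]
              exact fun h => hneg h.symm
          · rw [if_pos h2, if_neg]
            · rfl
            · intro h3
              rw [← h3] at h2
              exact hneg h2.symm
      · have hX := fun h1 => hac ((Affine.Point.X_eq_iff (h₁ := h') (h₂ := h)).mpr h1)
        rw [if_neg fun h1 => hX (.inl h1), if_neg fun h1 => hX (.inr h1)]
        refine G.ord_eq_of_v_eq ?_
        rw [xSub, G.v_translate_x_sub_of_ne_x h' hac]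
        rfl

/-- The group of principal divisors. -/
def principal : AddSubgroup ((E⁄K).toAffine.Point → ℤ) where
  carrier := {D | ∃ g, g ≠ 0 ∧ G.ord g = D}
  zero_mem' := ⟨1, one_ne_zero, G.ord_one⟩
  add_mem' := by
    rintro _ _ ⟨f, hf, rfl⟩ ⟨g, hg, rfl⟩
    exact ⟨f * g, mul_ne_zero hf hg, G.ord_mul hf hg⟩
  neg_mem' := by
    rintro _ ⟨f, hf, rfl⟩
    exact ⟨f⁻¹, inv_ne_zero hf, G.ord_inv f⟩

lemma mem_principal {D : (E⁄K).toAffine.Point → ℤ} :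
    D ∈ G.principal ↔ ∃ g, g ≠ 0 ∧ G.ord g = D := Iff.rfl

variable (hdiv : ∀ P : (E⁄K).toAffine.Point, ∃ Q, Q + Q = P)

include hdiv in
-- Write P - Q = 2A. The quotient of x - x(A) by x - x(P - A) has divisor (A) + (-A) - (P - A) - (A
-- - P); shifting it by P - A gives the required one.
lemma delta_mem_principal (P Q : (E⁄K).toAffine.Point) :
    delta P + delta Q - delta (P + Q) - delta 0 ∈ G.principal := by
  obtain ⟨A, hA⟩ := hdiv (P - Q)
  have hQ : P - A - A = Q := by rw [sub_sub, hA, sub_sub_cancel]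
  refine ⟨G.translate (-(P - A)) (G.xSub A * (G.xSub (P - A))⁻¹), G.translate_ne_zero
    (mul_ne_zero (G.xSub_ne_zero _) (inv_ne_zero (G.xSub_ne_zero _))) _, ?_⟩
  ext R
  rw [ord_translate, ord_mul _ (G.xSub_ne_zero _) (inv_ne_zero (G.xSub_ne_zero _)), ord_inv]
  simp only [Pi.add_apply, Pi.neg_apply, Pi.sub_apply, ord_xSub, delta_add]
  rw [show A - -(P - A) = P by abel, show -A - -(P - A) = Q by rw [← hQ]; abel,
    show P - A - -(P - A) = P + Q by rw [← hQ]; abel, show -(P - A) - -(P - A) = 0 by abel]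
  ring

/-- The class of the divisor `(P) - (O)`. -/
def divisorClass : (E⁄K).toAffine.Point →+ ((E⁄K).toAffine.Point → ℤ) ⧸ G.principal where
  toFun P := QuotientAddGroup.mk (delta P - delta 0)
  map_zero' := by rw [sub_self]; rfl
  map_add' P Q := by
    rw [← QuotientAddGroup.mk_add, eq_comm, QuotientAddGroup.eq, ← neg_mem_iff]
    convert G.delta_mem_principal hdiv P Q using 1
    abel

end WeierstrassCurve.GenericPoint

end

/-! ### Torsion bases, Abel's theorem and functions negated by a translation of order two -/

noncomputable section

open Polynomial WithZero

/-- Two elements forming a basis of the `n`-torsion over `ℤ/n`. -/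
structure IsTorsionBasis {A : Type*} [AddCommGroup A] (n : ℕ) (P Q : A) : Prop where
  left : n • P = 0
  right : n • Q = 0
  span : ∀ R : A, n • R = 0 → ∃ a b : ℤ, R = a • P + b • Q
  indep : ∀ a b : ℤ, a • P + b • Q = 0 → (n : ℤ) ∣ a ∧ (n : ℤ) ∣ b

namespace IsTorsionBasis

open WeierstrassCurve.GenericPoint

variable {A : Type*} [AddCommGroup A] {n : ℕ} {P Q : A} (hPQ : IsTorsionBasis n P Q)

include hPQ

lemma symm : IsTorsionBasis n Q P where
  left := hPQ.right
  right := hPQ.left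
  span R hR := by
    obtain ⟨a, b, h⟩ := hPQ.span R hR
    exact ⟨b, a, by rw [h, add_comm]⟩
  indep a b h := (hPQ.indep b a (by rw [add_comm, h])).symm

lemma exists_nat (hn : 0 < n) {R : A} (hR : n • R = 0) :
    ∃ a b : ℕ, a < n ∧ b < n ∧ R = a • P + b • Q := by
  obtain ⟨a, b, rfl⟩ := hPQ.span R hR
  have hn' : (0 : ℤ) < n := by exact_mod_cast hn
  have key : ∀ (a : ℤ) (X : A), n • X = 0 → (a % n).toNat • X = a • X := by
    intro a X hX
    rw [← natCast_zsmul, Int.toNat_of_nonneg (Int.emod_nonneg _ hn'.ne')]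
    conv_rhs => rw [← Int.emod_add_mul_ediv a n, add_smul, mul_comm, mul_smul, natCast_zsmul, hX,
      smul_zero, add_zero]
  refine ⟨(a % n).toNat, (b % n).toNat, ?_, ?_, ?_⟩
  · have := Int.emod_lt_of_pos a hn'
    have := Int.emod_nonneg a hn'.ne'
    omega
  · have := Int.emod_lt_of_pos b hn'
    have := Int.emod_nonneg b hn'.ne'
    omega
  · rw [key a P hPQ.left, key b Q hPQ.right]

lemma nat_inj {a b a' b' : ℕ} (ha : a < n) (hb : b < n) (ha' : a' < n) (hb' : b' < n)
    (h : a • P + b • Q = a' • P + b' • Q) : a = a' ∧ b = b' := by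
  have h1 := hPQ.indep (a - a') (b - b') (by
    rw [sub_smul, sub_smul, natCast_zsmul, natCast_zsmul, natCast_zsmul, natCast_zsmul,
      sub_add_sub_comm, h, sub_self])
  have key : ∀ a a' : ℕ, a < n → a' < n → (n : ℤ) ∣ a - a' → a = a' := by
    intro a a' ha ha' h
    have := Int.eq_zero_of_abs_lt_dvd h (by rw [abs_lt]; constructor <;> omega)
    omega
  exact ⟨key a a' ha ha' h1.1, key b b' hb hb' h1.2⟩

/-- The fibre of multiplication by n over B is the coset of B' modulo the n-torsion, and each
torsion point is aP + bQ for exactly one pair a, b < n. -/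
lemma sum_delta (hn : 0 < n) {B B' : A} (hB : n • B' = B) (R : A) :
    ∑ a ∈ Finset.range n, ∑ b ∈ Finset.range n, delta (B' + (a • P + b • Q)) R =
      delta B (n • R) := by
  have hker : ∀ a b : ℕ, n • (a • P + b • Q) = 0 := fun a b => by
    rw [smul_add, smul_comm n a, smul_comm n b, hPQ.left, hPQ.right, smul_zero, smul_zero,
      add_zero]
  by_cases h : n • R = B
  · obtain ⟨a, b, ha, hb, hab⟩ := hPQ.exists_nat hn (R := R - B') (by rw [smul_sub, hB, h, sub_self])
    have hR : R = B' + (a • P + b • Q) := by rw [← hab, add_sub_cancel]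
    rw [Finset.sum_eq_single a, Finset.sum_eq_single b, delta, delta, if_pos hR, if_pos h]
    · intro b' hb' hne
      rw [delta, if_neg]
      intro h1
      rw [hR, add_right_inj] at h1
      exact hne (hPQ.nat_inj ha hb ha (Finset.mem_range.mp hb') h1).2.symm
    · exact fun h => absurd (Finset.mem_range.mpr hb) h
    · intro a' ha' hne
      refine Finset.sum_eq_zero fun b' hb' => ?_
      rw [delta, if_neg]
      intro h1
      rw [hR, add_right_inj] at h1
      exact hne (hPQ.nat_inj ha hb (Finset.mem_range.mp ha') (Finset.mem_range.mp hb') h1).1.symm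
    · exact fun h => absurd (Finset.mem_range.mpr ha) h
  · rw [delta, if_neg h]
    refine Finset.sum_eq_zero fun a _ => Finset.sum_eq_zero fun b _ => ?_
    rw [delta, if_neg]
    rintro rfl
    rw [smul_add, hker, add_zero] at h
    exact h hB

end IsTorsionBasis

namespace WeierstrassCurve.GenericPoint

variable {F K L : Type*} [Field F] [Field K] [Field L] [Algebra F K] [Algebra F L] [Algebra K L]
  {E : WeierstrassCurve F} (G : GenericPoint E K L) [E.IsElliptic] [IsScalarTower F K L]
  [IsAlgClosed K] (hdiv : ∀ P : (E⁄K).toAffine.Point, ∃ Q, Q + Q = P)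

lemma mk_delta_sub (P Q : (E⁄K).toAffine.Point) :
    (QuotientAddGroup.mk (delta P - delta Q) : ((E⁄K).toAffine.Point → ℤ) ⧸ G.principal) =
      G.divisorClass hdiv (P - Q) := by
  rw [map_sub]
  change _ = QuotientAddGroup.mk (delta P - delta 0) - QuotientAddGroup.mk (delta Q - delta 0)
  rw [← QuotientAddGroup.mk_sub, sub_sub_sub_cancel_right]

include hdiv in
-- One direction of Abel's theorem. The common index set takes care of the degree.
lemma sum_delta_mem_principal (ι : Type*) (s : Finset ι) (f g : ι → (E⁄K).toAffine.Point)
    (h : ∑ i ∈ s, f i = ∑ i ∈ s, g i) : ∑ i ∈ s, (delta (f i) - delta (g i)) ∈ G.principal := by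
  rw [← QuotientAddGroup.eq_zero_iff, ← QuotientAddGroup.mk'_apply, map_sum]
  simp only [QuotientAddGroup.mk'_apply, G.mk_delta_sub hdiv]
  rw [← map_sum, Finset.sum_sub_distrib, h, sub_self, map_zero]

section TwoTorsion

/-- The function `(2y + a₁x + a₃) / (x - x(S))`, for a point `S` of order two. -/
def antisym (s t : K) : L := 2 * G.slope s t + algebraMap K L (E⁄K).a₁

variable [NeZero (2 : K)] {s t : K} (hS : (E⁄K).toAffine.Nonsingular s t)
  (hψ : 2 * t + (E⁄K).a₁ * s + (E⁄K).a₃ = 0)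

include hψ in
lemma antisym_mul : G.antisym s t * (G.x - algebraMap K L s) =
    aeval G.x (C (E⁄K).a₁ * X + C (E⁄K).a₃) + aeval G.x (C 2 : K[X]) * G.y := by
  have h1 := congrArg (algebraMap K L) hψ
  have h2 := G.slope_mul s t
  simp only [map_add, map_mul, map_ofNat, map_zero, aeval_X, aeval_C] at h1 ⊢
  rw [antisym]
  linear_combination 2 * h2 - h1

include hψ in
-- Translation by S replaces the slope m of the line through S by -m - a₁, as the addition law
-- shows.
lemma translate_antisym : G.translate (.some s t hS) (G.antisym s t) = -G.antisym s t := by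
  have h1 := (G.translate_some hS).2
  rw [hψ, map_zero, sub_zero] at h1
  have h2 : G.translate (.some s t hS) G.x - algebraMap K L s ≠ 0 := by
    rw [← translate_algebraMap G (.some s t hS) s, ← map_sub]
    exact G.translate_ne_zero (G.x_sub_ne_zero s) _
  have h3 : G.translate (.some s t hS) (G.slope s t) = -(G.slope s t + algebraMap K L (E⁄K).a₁) := by
    refine mul_right_cancel₀ h2 ?_
    rw [← h1]
    have := congrArg (G.translate (.some s t hS)) (G.slope_mul s t)
    simpa only [map_mul, map_sub, translate_algebraMap] using this
  rw [antisym, map_add, map_mul, h3, map_ofNat, translate_algebraMap]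
  ring

lemma v_antisym : G.v (G.antisym s t) = exp 1 := by
  have h2 : (2 : K) ≠ 0 := NeZero.ne 2
  have h : G.antisym s t = algebraMap K L 2 * (G.slope s t + algebraMap K L ((E⁄K).a₁ / 2)) := by
    rw [antisym, mul_add, ← map_mul, mul_div_cancel₀ _ h2, map_ofNat]
  rw [h, map_mul, G.v_algebraMap _ h2, one_mul, G.v_slope_add]

lemma antisym_ne_zero : G.antisym s t ≠ 0 := fun h => by
  have := G.v_antisym (s := s) (t := t)
  rw [h, map_zero] at this
  exact exp_ne_zero this.symm

include hψ in
-- The numerator 2y + a₁x + a₃ vanishes at T. There is a simple pole at O, and invariance of the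
-- divisor under translation by S transfers this information to T + S and S.
lemma le_ord_antisym {T : (E⁄K).toAffine.Point} (hT : T + T = 0) (hT0 : T ≠ 0)
    (hTS : T ≠ .some s t hS) : 
    delta T + delta (T + .some s t hS) - delta 0 - delta (.some s t hS) ≤
      G.ord (G.antisym s t) := by
  have hneg := (neg_eq_self_iff hS).mpr hψ
  set S := Affine.Point.some s t hS with hSdef
  have h0 : G.ord (G.antisym s t) 0 = -1 := by
    refine G.ord_eq_of_v_eq ?_
    rw [translate_zero, v_antisym]
    rfl
  have hswap : ∀ R, G.ord (G.antisym s t) (R + S) = G.ord (G.antisym s t) R := by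
    intro R
    rw [← ord_translate, G.translate_antisym hS hψ, ord, map_neg, Valuation.map_neg, ord]
  have hSS : S + S = 0 := by
    nth_rw 1 [← hneg]
    exact neg_add_cancel S
  have hreg : ∀ R, R ≠ 0 → R ≠ S → 0 ≤ G.ord (G.antisym s t) R ∧
      (R = T → 1 ≤ G.ord (G.antisym s t) R) := by
    intro R hR0 hRS
    have hv := G.v_eq_exp_ord (G.antisym_ne_zero (s := s) (t := t)) R
    rcases R with _ | ⟨c, d, hcd⟩
    · exact absurd rfl hR0
    have hcs : c ≠ s := fun h => by
      rcases (Affine.Point.X_eq_iff (h₁ := hcd) (h₂ := hS)).mp h with h | h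
      · exact hRS h
      · exact hRS (h.trans hneg)
    have h1 := congrArg (fun z => G.v (G.translate (.some c d hcd) z)) (G.antisym_mul hψ)
    simp only [map_mul] at h1
    rw [G.v_translate_x_sub_of_ne_x hcd hcs, mul_one] at h1
    constructor
    · have h2 := G.v_translate_form_le_one hcd (C (E⁄K).a₁ * X + C (E⁄K).a₃) (C 2)
      rw [← h1, hv, ← exp_zero, exp_le_exp] at h2
      linarith
    · rintro rfl
      have h2 := (G.v_translate_form_lt_one_iff hcd (C (E⁄K).a₁ * X + C (E⁄K).a₃) (C 2)).mpr (by
        have h3 := (neg_eq_self_iff hcd).mp (neg_eq_of_add_eq_zero_left hT)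
        simp only [eval_add, eval_mul, eval_C, eval_X]
        linear_combination h3)
      rw [← h1, hv, ← exp_zero, exp_lt_exp] at h2
      linarith
  have hS0 : S ≠ 0 := Affine.Point.some_ne_zero _
  have hTS' : T + S ≠ S := by simpa using hT0
  have hTS0 : T + S ≠ 0 := fun h => hTS (by rw [eq_neg_of_add_eq_zero_left h, hneg])
  have hne : T + S ≠ T := fun h => hS0 (add_eq_left.mp h)
  intro R
  simp only [Pi.add_apply, Pi.sub_apply, delta]
  by_cases hR0 : R = 0
  · rw [hR0, h0, if_neg hT0.symm, if_neg hTS0.symm, if_pos rfl, if_neg hS0.symm]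
    norm_num
  by_cases hRS : R = S
  · have h1 := hswap 0
    rw [zero_add, h0] at h1
    rw [hRS, h1, if_neg hTS.symm, if_neg hTS'.symm, if_neg hS0, if_pos rfl]
    norm_num
  rw [if_neg hR0, if_neg hRS]
  by_cases hRT : R = T
  · have := (hreg R hR0 hRS).2 hRT
    rw [if_pos hRT, if_neg (hRT ▸ hne.symm)]
    linarith
  by_cases hRTS : R = T + S
  · have := (hreg T hT0 hTS).2 rfl
    rw [if_neg hRT, if_pos hRTS, hRTS, hswap]
    linarith
  · have := (hreg R hR0 hRS).1
    rw [if_neg hRT, if_neg hRTS]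
    linarith

include hdiv in
lemma exists_antisym {S T : (E⁄K).toAffine.Point} (hS2 : S + S = 0) (hS0 : S ≠ 0)
    (hT : T + T = 0) (hT0 : T ≠ 0) (hTS : T ≠ S) :
    ∃ k : L, k ≠ 0 ∧ G.ord k = delta T + delta (T + S) - delta 0 - delta S ∧
      G.translate S k = -k := by
  have h1 := G.sum_delta_mem_principal hdiv (Fin 2) Finset.univ ![T, T + S] ![0, S] (by
    simp only [Fin.sum_univ_two, Matrix.cons_val_zero, Matrix.cons_val_one]
    rw [← add_assoc, hT])
  obtain ⟨k, hk0, hk⟩ := h1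
  have hk' : G.ord k = delta T + delta (T + S) - delta 0 - delta S := by
    rw [hk]
    simp only [Fin.sum_univ_two, Matrix.cons_val_zero, Matrix.cons_val_one]
    abel
  refine ⟨k, hk0, hk', ?_⟩
  rcases S with _ | ⟨s, t, hS⟩
  · exact absurd rfl hS0
  have hψ := (neg_eq_self_iff hS).mp (neg_eq_of_add_eq_zero_left hS2)
  -- The explicit function is a constant multiple of k, so k inherits its sign change.
  obtain ⟨c, hc, h2⟩ := G.exists_eq_algebraMap_mul G.antisym_ne_zero hk0
    (hk'.trans_le (G.le_ord_antisym hS hψ hT hT0 hTS))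
  have h3 := G.translate_antisym hS hψ
  rw [h2, map_mul, translate_algebraMap, ← mul_neg] at h3
  exact mul_left_cancel₀ (by simpa using hc) h3

end TwoTorsion

end WeierstrassCurve.GenericPoint

end

/-! ### The Weil function and the root of unity fixed by a transvection -/

noncomputable section

namespace WeierstrassCurve.GenericPoint

variable {F K L : Type*} [Field F] [Field K] [Field L] [Algebra F K] [Algebra F L] [Algebra K L]
  {E : WeierstrassCurve F} (G : GenericPoint E K L) [E.IsElliptic] [IsScalarTower F K L]
  [IsAlgClosed K] (hdiv : ∀ P : (E⁄K).toAffine.Point, ∃ Q, Q + Q = P)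
  {n : ℕ} {P Q P' : (E⁄K).toAffine.Point} (hPQ : IsTorsionBasis n P Q) (hP' : n • P' = P)

/-- The divisor `[n]^*((P) - (O))`. -/
def weilDivisor (n : ℕ) (P : (E⁄K).toAffine.Point) (R : (E⁄K).toAffine.Point) : ℤ :=
  delta P (n • R) - delta 0 (n • R)

include hPQ hP' in
lemma weilDivisor_eq (hn : 0 < n) : weilDivisor n P = ∑ a ∈ Finset.range n, ∑ b ∈ Finset.range n,
    (delta (P' + (a • P + b • Q)) - delta (a • P + b • Q)) := by
  ext R
  rw [weilDivisor, ← hPQ.sum_delta hn hP' R, ← hPQ.sum_delta hn (smul_zero n) R]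
  simp only [zero_add, Finset.sum_apply, Pi.sub_apply, Finset.sum_sub_distrib]

include hdiv hPQ hP' in
-- Zeros and poles form two cosets of the n-torsion whose sums differ by n²P' = nP = 0, so Abel's
-- theorem applies.
lemma exists_weilFunction (hn : 0 < n) : ∃ g : L, g ≠ 0 ∧ G.ord g = weilDivisor n P := by
  have h := G.sum_delta_mem_principal hdiv (ℕ × ℕ) (Finset.range n ×ˢ Finset.range n)
    (fun i => P' + (i.1 • P + i.2 • Q)) (fun i => i.1 • P + i.2 • Q) (by
      rw [Finset.sum_add_distrib, Finset.sum_const, Finset.card_product, Finset.card_range,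
        mul_smul, hP', hPQ.left, zero_add])
  rw [Finset.sum_product, ← weilDivisor_eq hPQ hP' hn] at h
  exact G.mem_principal.mp h

lemma exists_translate_eq {g : L} (hg0 : g ≠ 0) (hg : G.ord g = weilDivisor n P)
    {R : (E⁄K).toAffine.Point} (hR : n • R = 0) :
    ∃ c : K, c ≠ 0 ∧ G.translate R g = algebraMap K L c * g := by
  refine G.exists_eq_algebraMap_mul (G.translate_ne_zero hg0 R) hg0 (le_of_eq ?_)
  ext A
  rw [ord_translate, hg, weilDivisor, weilDivisor, smul_add, hR, add_zero]

include hP' in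
-- This is e(P, P) = 1. The product of the translates of g by iP', for i < n, has a telescoping
-- divisor, so it is constant. Translating it by P' replaces the factor i = 0 by the factor i = n,
-- where nP' = P.
lemma translate_self {g : L} (hg0 : g ≠ 0) (hg : G.ord g = weilDivisor n P) (hP : n • P = 0) :
    G.translate P g = g := by
  have hne : ∀ R, G.translate R g ≠ 0 := fun R => G.translate_ne_zero hg0 R
  obtain ⟨c, hc, h⟩ := G.exists_eq_algebraMap (g := ∏ i ∈ Finset.range n, G.translate (i • P') g)
    (Finset.prod_ne_zero_iff.mpr fun i _ => hne _) (ge_of_eq (by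
      rw [ord_prod _ _ _ fun i _ => hne _]
      ext A
      have h1 : ∀ i : ℕ, G.ord (G.translate (i • P') g) A =
          delta P (n • A + i • P) - delta P (n • A + (i + 1) • P) := by
        intro i
        rw [ord_translate, hg, weilDivisor, smul_add, smul_comm n i, hP']
        congr 1
        refine delta_congr ?_
        rw [add_smul, one_smul, ← add_assoc, add_eq_right]
      rw [Finset.sum_apply, Finset.sum_congr rfl fun i _ => h1 i,
        Finset.sum_range_sub' (fun i => delta P (n • A + i • P)), hP, zero_smul, sub_self]
      rfl))
  have h1 := congrArg (G.translate P') h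
  rw [translate_algebraMap, ← h, map_prod] at h1
  simp only [translate_translate] at h1
  have h2 := Finset.prod_range_succ (fun i => G.translate (i • P') g) n
  have h3 := Finset.prod_range_succ' (fun i => G.translate (i • P') g) n
  simp only [add_comm, add_smul, one_smul, zero_smul, translate_zero, hP'] at h1 h2 h3
  rw [h1, h2] at h3
  exact mul_left_cancel₀ (Finset.prod_ne_zero_iff.mpr fun i _ => hne _) h3

variable [NeZero (2 : K)]

include hdiv hPQ hP' in
-- Put S = hQ and T = hP. The divisor of g is D' plus its translate by S, where D' collects the
-- terms with b < h. Then g is a constant times u · τ_S(u) · k, with div u = D' - (T) + (O) and div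
-- k = (T) + (T + S) - (O) - (S). Translation by S swaps the first two factors and negates k.
lemma translate_half {h : ℕ} (hn : n = h + h) (hh : 0 < h) {g : L} (hg0 : g ≠ 0)
    (hg : G.ord g = weilDivisor n P) : G.translate (h • Q) g = -g := by
  have hnpos : 0 < n := by omega
  have hS : h • Q + h • Q = 0 := by rw [← add_smul, ← hn, hPQ.right]
  have hT : h • P + h • P = 0 := by rw [← add_smul, ← hn, hPQ.left]
  have hnd : ¬ (n : ℤ) ∣ h := fun hd => by
    have := Int.le_of_dvd (by exact_mod_cast hh) hd
    omega
  have hS0 : h • Q ≠ 0 := fun h0 => hnd (hPQ.indep 0 h (by simpa using h0)).2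
  have hT0 : h • P ≠ 0 := fun h0 => hnd (hPQ.indep h 0 (by simpa using h0)).1
  have hTS : h • P ≠ h • Q := fun h0 => hnd (hPQ.indep h (-h) (by
    rw [neg_smul, natCast_zsmul, natCast_zsmul, h0, add_neg_cancel])).1
  obtain ⟨k, hk0, hk, hSk⟩ := G.exists_antisym hdiv hS hS0 hT hT0 hTS
  set D' : (E⁄K).toAffine.Point → ℤ := ∑ a ∈ Finset.range n, ∑ b ∈ Finset.range h,
    (delta (P' + (a • P + b • Q)) - delta (a • P + b • Q)) with hD'
  -- D' has nh terms, each of class P', and nhP' = hP = T.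
  have hu : D' - (delta (h • P) - delta 0) ∈ G.principal := by
    rw [← QuotientAddGroup.eq_zero_iff, QuotientAddGroup.mk_sub, G.mk_delta_sub hdiv, hD',
      ← Finset.sum_product', ← QuotientAddGroup.mk'_apply, map_sum]
    simp only [QuotientAddGroup.mk'_apply, G.mk_delta_sub hdiv, add_sub_cancel_right, sub_zero]
    rw [Finset.sum_const, Finset.card_product, Finset.card_range, Finset.card_range, ← map_nsmul,
      mul_comm, mul_smul, hP', sub_self]
  obtain ⟨u, hu0, hu⟩ := hu
  have hD : ∀ R, weilDivisor n P R = D' R + D' (R + h • Q) := by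
    intro R
    rw [weilDivisor_eq hPQ hP' hnpos, hD', Finset.sum_apply, Finset.sum_apply, Finset.sum_apply,
      ← Finset.sum_add_distrib]
    refine Finset.sum_congr rfl fun a _ => ?_
    rw [hn, Finset.sum_range_add, Pi.add_apply, Finset.sum_apply, Finset.sum_apply,
      Finset.sum_apply]
    congr 1
    refine Finset.sum_congr rfl fun b _ => ?_
    have hneg : -(h • Q) = h • Q := neg_eq_of_add_eq_zero_left hS
    simp only [Pi.sub_apply, delta_add, sub_eq_add_neg, hneg, add_smul]
    congr 2 <;> [skip; congr 1] <;> abel_nf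
  have hne : u * G.translate (h • Q) u * k ≠ 0 :=
    mul_ne_zero (mul_ne_zero hu0 (G.translate_ne_zero hu0 _)) hk0
  obtain ⟨c, hc, h1⟩ := G.exists_eq_algebraMap_mul hg0 hne (le_of_eq (by
    ext R
    rw [ord_mul _ (mul_ne_zero hu0 (G.translate_ne_zero hu0 _)) hk0,
      ord_mul _ hu0 (G.translate_ne_zero hu0 _), Pi.add_apply, Pi.add_apply, ord_translate, hu, hk,
      hg, hD]
    have hneg : -(h • Q) = h • Q := neg_eq_of_add_eq_zero_left hS
    have hsub : h • P - h • Q = h • P + h • Q := by rw [sub_eq_add_neg, hneg]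
    simp only [Pi.sub_apply, Pi.add_apply, delta_add, hsub, zero_sub, hneg]
    ring))
  rw [h1, map_mul, map_mul, map_mul, translate_translate, hS, translate_zero, hSk,
    translate_algebraMap]
  ring

include G hdiv hPQ hP' in
/-- A Galois automorphism acting on the `n`-torsion as a transvection fixes a root of unity `ζ`
with `ζ ^ (n / 2) = -1`. -/
theorem exists_pow_eq_neg_one {h : ℕ} (hn : n = h + h) (hh : 0 < h) (σ : K ≃ₐ[F] K)
    (hσP : Affine.Point.map (W' := E) (σ : K →ₐ[F] K) P = P)
    (hσQ : Affine.Point.map (W' := E) (σ : K →ₐ[F] K) Q = Q + P) :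
    ∃ ζ : K, ζ ^ h = -1 ∧ σ ζ = ζ := by
  have hnpos : 0 < n := by omega
  obtain ⟨g, hg0, hg⟩ := G.exists_weilFunction hdiv hPQ hP' hnpos
  obtain ⟨ζ, hζ, hQ⟩ := G.exists_translate_eq hg0 hg hPQ.right
  have hP := G.translate_self hP' hg0 hg hPQ.left
  have hpow : ∀ i : ℕ, G.translate (i • Q) g = algebraMap K L (ζ ^ i) * g := by
    intro i
    induction i with
    | zero => simp
    | succ i ih =>
      rw [add_smul, one_smul, ← translate_translate, hQ, map_mul, translate_algebraMap, ih, pow_succ,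
        map_mul]
      ring
  refine ⟨ζ, ?_, ?_⟩
  · have h1 := hpow h
    rw [G.translate_half hdiv hPQ hP' hn hh hg0 hg, neg_eq_neg_one_mul] at h1
    have h2 := mul_right_cancel₀ hg0 h1
    rw [← map_one (algebraMap K L), ← map_neg] at h2
    exact ((algebraMap K L).injective h2).symm
  · have hcomp : ∀ R, Affine.Point.map (W' := E) (σ : K →ₐ[F] K)
        (Affine.Point.map (W' := E) (σ.symm : K →ₐ[F] K) R) = R := by
      intro R
      rcases R with _ | ⟨a, b, hab⟩
      · rfl
      · rw [Affine.Point.map_some, Affine.Point.map_some, Affine.Point.some.injEq]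
        exact ⟨σ.apply_symm_apply a, σ.apply_symm_apply b⟩
    have hinj := Affine.Point.map_injective (W' := E) (σ : K →ₐ[F] K)
    have hcg0 : G.conjugate (σ : K →ₐ[F] K) g ≠ 0 :=
      (map_ne_zero_iff _ (G.conjugate (σ : K →ₐ[F] K)).toRingHom.injective).mpr hg0
    -- Since σ fixes P and O, it preserves the divisor of g.
    obtain ⟨c, hc, h1⟩ := G.exists_eq_algebraMap_mul hcg0 hg0 (le_of_eq (by
      ext R
      rw [← hcomp R, ord_conjugate, hg, weilDivisor, weilDivisor, ← map_nsmul]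
      congr 1
      · refine delta_congr ?_
        nth_rw 1 [← hσP]
        exact hinj.eq_iff
      · exact delta_congr (map_eq_zero_iff _ hinj)))
    -- Conjugating τ_Q(g) = ζg by σ gives τ_{Q+P}(cg) = σ(ζ)cg, while τ_P fixes g.
    have h2 := congrArg (G.conjugate (σ : K →ₐ[F] K)) hQ
    rw [conjugate_translate, hσQ, map_mul, conjugate_algebraMap, h1, map_mul, translate_algebraMap,
      ← translate_translate, hP, hQ] at h2
    have h3 : algebraMap K L (σ ζ) = algebraMap K L ζ := by
      have hc' : algebraMap K L c ≠ 0 := by simpa using hc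
      refine mul_right_cancel₀ (mul_ne_zero hc' hg0) (h2.symm.trans ?_)
      ring
    exact (algebraMap K L).injective h3

end WeierstrassCurve.GenericPoint

end

/-! ### Two-divisibility and bases of the 2-power torsion -/

noncomputable section

open Polynomial

namespace IsTorsionBasis

variable {A : Type*} [AddCommGroup A]

lemma one : IsTorsionBasis 1 (0 : A) 0 where
  left := smul_zero 1
  right := smul_zero 1
  span R hR := ⟨0, 0, by simpa using hR⟩
  indep a b _ := by simp

lemma lift {n : ℕ} {P Q : A} (h2 : IsTorsionBasis 2 (n • P) (n • Q))
    (hn : IsTorsionBasis n (2 • P) (2 • Q)) : IsTorsionBasis (n * 2) P Q where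
  left := by rw [mul_smul, hn.left]
  right := by rw [mul_smul, hn.right]
  span R hR := by
    obtain ⟨a, b, hab⟩ := hn.span (2 • R) (by rw [← mul_smul, hR])
    obtain ⟨c, d, hcd⟩ := h2.span (R - a • P - b • Q) (by
      rw [smul_sub, smul_sub, hab, smul_comm 2 a, smul_comm 2 b]; abel)
    refine ⟨a + c * n, b + d * n, ?_⟩
    rw [add_smul, add_smul, mul_smul, mul_smul, natCast_zsmul, natCast_zsmul, add_add_add_comm,
      ← hcd]
    abel
  indep a b h := by
    obtain ⟨⟨c, rfl⟩, ⟨d, rfl⟩⟩ := hn.indep a b (by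
      rw [smul_comm a, smul_comm b, ← smul_add, h, smul_zero])
    obtain ⟨h1, h2⟩ := h2.indep c d (by
      rw [← natCast_zsmul P, ← natCast_zsmul Q, ← mul_smul, ← mul_smul, mul_comm c, mul_comm d, h])
    push_cast
    exact ⟨mul_dvd_mul_left _ h1, mul_dvd_mul_left _ h2⟩

lemma of_two {P Q : A} (hP : P + P = 0) (hQ : Q + Q = 0) (hP0 : P ≠ 0) (hQ0 : Q ≠ 0) (hPQ : P ≠ Q)
    (h : ∀ R : A, R + R = 0 → R = 0 ∨ R = P ∨ R = Q ∨ R = P + Q) : IsTorsionBasis 2 P Q where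
  left := by rw [two_smul, hP]
  right := by rw [two_smul, hQ]
  span R hR := by
    rw [two_smul] at hR
    rcases h R hR with rfl | rfl | rfl | rfl
    · exact ⟨0, 0, by simp⟩
    · exact ⟨1, 0, by simp⟩
    · exact ⟨0, 1, by simp⟩
    · exact ⟨1, 1, by simp⟩
  indep a b hab := by
    have key : ∀ (X : A), X + X = 0 → ∀ a : ℤ, a • X = (a % 2) • X := fun X hX a => by
      conv_lhs => rw [← Int.emod_add_mul_ediv a 2, add_smul, mul_comm, mul_smul, two_smul, hX,
        smul_zero, add_zero]
    rw [key P hP, key Q hQ] at hab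
    have hPQ0 : P + Q ≠ 0 := fun h0 => hPQ (by
      rw [eq_neg_of_add_eq_zero_left h0, neg_eq_of_add_eq_zero_left hQ])
    rcases Int.emod_two_eq_zero_or_one a with ha | ha <;>
      rcases Int.emod_two_eq_zero_or_one b with hb | hb <;> rw [ha, hb] at hab
    · exact ⟨Int.dvd_of_emod_eq_zero ha, Int.dvd_of_emod_eq_zero hb⟩
    · exact absurd (by simpa using hab) hQ0
    · exact absurd (by simpa using hab) hP0
    · exact absurd (by simpa using hab) hPQ0

/-- Compatible sequences of halves give compatible bases of the `2 ^ m`-torsion. -/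
lemma pow_two {p q : ℕ → A} (h0 : IsTorsionBasis 2 (p 1) (q 1))
    (hp : ∀ m, 2 • p (m + 1) = p m) (hq : ∀ m, 2 • q (m + 1) = q m) (m : ℕ) :
    IsTorsionBasis (2 ^ m) (p m) (q m) := by
  have key : ∀ r : ℕ → A, (∀ m, 2 • r (m + 1) = r m) → ∀ m, 2 ^ m • r (m + 1) = r 1 := by
    intro r hr m
    induction m with
    | zero => simp
    | succ m ih => rw [pow_succ, mul_smul, hr, ih]
  induction m with
  | zero =>
    have hp0 : p 0 = 0 := by rw [← hp, h0.left]
    have hq0 : q 0 = 0 := by rw [← hq, h0.right]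
    rw [hp0, hq0, pow_zero]
    exact one
  | succ m ih =>
    rw [pow_succ]
    refine lift ?_ ?_
    · rwa [key p hp, key q hq]
    · rwa [hp, hq]

end IsTorsionBasis

lemma exists_halves {A : Type*} [AddCommGroup A] (hdiv : ∀ P : A, ∃ Q, Q + Q = P) {P : A}
    (hP : P + P = 0) : ∃ p : ℕ → A, p 1 = P ∧ ∀ m, 2 • p (m + 1) = p m := by
  choose f hf using hdiv
  -- The sequence starts with 0 at index 0, and P sits at index 1; halving is iterated from there.
  refine ⟨fun m => Nat.casesOn m 0 fun k => f^[k] P, rfl, fun m => ?_⟩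
  rcases m with _ | m
  · exact (two_smul _ _).trans hP
  · change 2 • f^[m + 1] P = f^[m] P
    rw [two_smul, Function.iterate_succ_apply', hf]

namespace WeierstrassCurve

variable {K : Type*} [Field K] (W : WeierstrassCurve K)

/-- A Bézout certificate: the numerator and denominator of the duplication formula for x generate Δ.
-/
lemma duplication_coprime (x : K) (h1 : x ^ 4 - W.b₄ * x ^ 2 - 2 * W.b₆ * x - W.b₈ = 0)
    (h2 : 4 * x ^ 3 + W.b₂ * x ^ 2 + 2 * W.b₄ * x + W.b₆ = 0) : W.Δ = 0 := by
  have h3 := W.b_relation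
  rw [Δ]
  linear_combination (-48 * x ^ 2 - 8 * W.b₂ * x + W.b₂ ^ 2 - 32 * W.b₄) * h1 +
    (12 * x ^ 3 - W.b₂ * x ^ 2 - 10 * W.b₄ * x + W.b₂ * W.b₄ - 27 * W.b₆) * h2 +
    (-8 * W.b₄ - 12 * x ^ 2 - 2 * W.b₂ * x) * h3

variable [IsAlgClosed K] [W.IsElliptic]

/-- The group of points over an algebraically closed field is `2`-divisible. -/
theorem exists_add_self_eq (P : W.toAffine.Point) : ∃ Q, Q + Q = P := by
  rcases P with _ | ⟨x₀, y₀, h₀⟩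
  · exact ⟨0, add_zero _⟩
  -- The quartic expresses x(2Q) = x₀ for a point Q with x(Q) = r, after clearing the denominator.
  obtain ⟨r, hr⟩ := IsAlgClosed.exists_root ((C 1 * X ^ 4 + C (-4 * x₀) * X ^ 3 +
    C (-W.b₄ - x₀ * W.b₂) * X ^ 2 + C (-2 * W.b₆ - 2 * x₀ * W.b₄) * X +
    C (-W.b₈ - x₀ * W.b₆) : K[X])) (by
      have : ((C 1 * X ^ 4 + C (-4 * x₀) * X ^ 3 +
        C (-W.b₄ - x₀ * W.b₂) * X ^ 2 + C (-2 * W.b₆ - 2 * x₀ * W.b₄) * X +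
        C (-W.b₈ - x₀ * W.b₆) : K[X])).degree = 4 := by compute_degree!
      rw [this]
      norm_num)
  simp only [IsRoot, eval_add, eval_mul, eval_pow, eval_C, eval_X] at hr
  obtain ⟨y, hy⟩ := W.exists_nonsingular_of_isAlgClosed r
  have hE := (Affine.equation_iff _ _).mp hy.1
  have hψ2 : (2 * y + W.a₁ * r + W.a₃) ^ 2 =
      4 * r ^ 3 + W.b₂ * r ^ 2 + 2 * W.b₄ * r + W.b₆ := by
    rw [b₂, b₄, b₆]
    linear_combination 4 * hE
  have hψ : 2 * y + W.a₁ * r + W.a₃ ≠ 0 := by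
    intro h0
    rw [h0] at hψ2
    refine W.isUnit_Δ.ne_zero (W.duplication_coprime r ?_ ?_)
    · linear_combination hr - x₀ * hψ2
    · linear_combination -hψ2
  have hy' : y ≠ W.toAffine.negY r y := by
    rw [Affine.negY]
    intro h
    exact hψ (by linear_combination h)
  have hadd := Affine.Point.add_self_of_Y_ne (h₁ := hy) hy'
  have hx : W.toAffine.addX r r (W.toAffine.slope r r y y) = x₀ := by
    have hs : W.toAffine.slope r r y y * (2 * y + W.a₁ * r + W.a₃) =
        3 * r ^ 2 + 2 * W.a₂ * r + W.a₄ - W.a₁ * y := by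
      rw [Affine.slope_of_Y_ne rfl hy', Affine.negY]
      have : y - (-y - W.a₁ * r - W.a₃) = 2 * y + W.a₁ * r + W.a₃ := by ring
      rw [this, div_mul_cancel₀ _ hψ]
    rw [Affine.addX]
    generalize W.toAffine.slope r r y y = s at hs
    refine mul_right_cancel₀ (pow_ne_zero 2 hψ) ?_
    have h8 : W.b₈ = W.a₁ ^ 2 * W.a₆ + 4 * W.a₂ * W.a₆ - W.a₁ * W.a₃ * W.a₄ + W.a₂ * W.a₃ ^ 2 -
      W.a₄ ^ 2 := rfl
    rw [h8, b₂, b₄, b₆] at hr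
    linear_combination (s * (2 * y + W.a₁ * r + W.a₃) + 3 * r ^ 2 + 2 * W.a₂ * r + W.a₄ - W.a₁ * y +
      W.a₁ * (2 * y + W.a₁ * r + W.a₃)) * hs + hr -
      (W.a₁ ^ 2 + 4 * W.a₂ + 8 * r + 4 * x₀) * hE
  rcases Affine.Point.X_eq_iff (h₁ := Affine.nonsingular_add hy hy fun hxy => hy' hxy.right)
    (h₂ := h₀) |>.mp hx with h | h
  · exact ⟨.some r y hy, hadd.trans h⟩
  · exact ⟨-.some r y hy, by rw [← neg_add, hadd, h, neg_neg]⟩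

/-- The two-torsion of an elliptic curve over an algebraically closed field. -/
theorem exists_isTorsionBasis_two [NeZero (2 : K)] :
    ∃ P Q : W.toAffine.Point, IsTorsionBasis 2 P Q := by
  have h2 : (2 : K) ≠ 0 := NeZero.ne 2
  have h4 : W.twoTorsionPolynomial.a ≠ 0 := by
    change (4 : K) ≠ 0
    rw [show (4 : K) = 2 * 2 by norm_num]
    exact mul_ne_zero h2 h2
  obtain ⟨x₁, x₂, x₃, hx⟩ := (Cubic.splits_iff_roots_eq_three (φ := RingHom.id K) h4).mp
    (IsAlgClosed.splits _)
  obtain ⟨h12, h13, h23⟩ := (Cubic.discr_ne_zero_iff_roots_ne h4 hx).mp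
    (W.twoTorsionPolynomial_discr_ne_zero h2.isUnit W.isUnit_Δ)
  have hb := Cubic.b_eq_three_roots h4 hx
  have hc := Cubic.c_eq_three_roots h4 hx
  have hd := Cubic.d_eq_three_roots h4 hx
  simp only [twoTorsionPolynomial, RingHom.id_apply] at hb hc hd
  have hfac : ∀ x, 4 * x ^ 3 + W.b₂ * x ^ 2 + 2 * W.b₄ * x + W.b₆ =
      4 * ((x - x₁) * (x - x₂) * (x - x₃)) := fun x => by
    linear_combination x ^ 2 * hb + x * hc + hd
  have hψ2 : ∀ x y, W.toAffine.Equation x y → (2 * y + W.a₁ * x + W.a₃) ^ 2 =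
      4 * ((x - x₁) * (x - x₂) * (x - x₃)) := fun x y h => by
    rw [← hfac, b₂, b₄, b₆]
    linear_combination 4 * (Affine.equation_iff _ _).mp h
  have hex : ∀ x, (x - x₁) * (x - x₂) * (x - x₃) = 0 → ∃ y, ∃ h : W.toAffine.Nonsingular x y,
      Affine.Point.some x y h + .some x y h = 0 := by
    intro x hx
    obtain ⟨y, hy⟩ := W.exists_nonsingular_of_isAlgClosed x
    have h0 := hψ2 x y hy.1
    rw [hx, mul_zero] at h0
    have h0 := pow_eq_zero_iff (two_ne_zero) |>.mp h0
    refine ⟨y, hy, Affine.Point.add_self_of_Y_eq ?_⟩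
    rw [Affine.negY]
    linear_combination h0
  have heq : ∀ x y y' (h : W.toAffine.Nonsingular x y) (h' : W.toAffine.Nonsingular x y'),
      Affine.Point.some x y h + .some x y h = 0 → Affine.Point.some x y' h' = .some x y h := by
    intro x y y' h h' h0
    rcases Affine.Point.X_eq_iff (h₁ := h') (h₂ := h) |>.mp rfl with h1 | h1
    · exact h1
    · rw [h1, neg_eq_of_add_eq_zero_left h0]
  obtain ⟨y₁, n₁, t₁⟩ := hex x₁ (by ring)
  obtain ⟨y₂, n₂, t₂⟩ := hex x₂ (by ring)
  obtain ⟨y₃, n₃, t₃⟩ := hex x₃ (by ring)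
  have hall : ∀ R : W.toAffine.Point, R + R = 0 → R = 0 ∨ R = .some x₁ y₁ n₁ ∨
      R = .some x₂ y₂ n₂ ∨ R = .some x₃ y₃ n₃ := by
    intro R hR
    rcases R with _ | ⟨x, y, h⟩
    · exact .inl rfl
    right
    have h1 := eq_neg_of_add_eq_zero_left hR
    rw [Affine.Point.neg_some, Affine.Point.some.injEq, Affine.negY] at h1
    have h3 := hψ2 x y h.1
    have h5 : 2 * y + W.a₁ * x + W.a₃ = 0 := by linear_combination h1.2
    rw [h5, zero_pow two_ne_zero, eq_comm, mul_eq_zero, mul_eq_zero, mul_eq_zero, sub_eq_zero,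
      sub_eq_zero, sub_eq_zero] at h3
    rcases h3 with h3 | (h3 | h3) | h3
    · exact absurd h3 h4
    · subst h3
      exact .inl (heq _ _ _ _ _ t₁)
    · subst h3
      exact .inr (.inl (heq _ _ _ _ _ t₂))
    · subst h3
      exact .inr (.inr (heq _ _ _ _ _ t₃))
  have n12 : Affine.Point.some x₁ y₁ n₁ ≠ .some x₂ y₂ n₂ := fun h => by
    injection h with h _
    exact h12 h
  refine ⟨.some x₁ y₁ n₁, .some x₂ y₂ n₂, IsTorsionBasis.of_two t₁ t₂
    (Affine.Point.some_ne_zero _) (Affine.Point.some_ne_zero _) n12 fun R hR => ?_⟩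
  -- The sum of two distinct points of order two is 2-torsion and is neither 0 nor one of them, so
  -- it is the third.
  have hsum : Affine.Point.some x₁ y₁ n₁ + .some x₂ y₂ n₂ = .some x₃ y₃ n₃ := by
    rcases hall (.some x₁ y₁ n₁ + .some x₂ y₂ n₂) (by rw [add_add_add_comm, t₁, t₂, add_zero])
      with h | h | h | h
    · exact absurd ((eq_neg_of_add_eq_zero_left h).trans (neg_eq_of_add_eq_zero_left t₂)) n12
    · exact absurd (add_eq_left.mp h) (Affine.Point.some_ne_zero _)
    · exact absurd (add_eq_right.mp h) (Affine.Point.some_ne_zero _)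
    · exact h
  rw [hsum]
  exact hall R hR

/-- Compatible bases of the `2 ^ m`-torsion. -/
theorem exists_isTorsionBasis_pow_two [NeZero (2 : K)] : ∃ p q : ℕ → W.toAffine.Point,
    (∀ m, 2 • p (m + 1) = p m) ∧ (∀ m, 2 • q (m + 1) = q m) ∧
    ∀ m, IsTorsionBasis (2 ^ m) (p m) (q m) := by
  obtain ⟨P, Q, h⟩ := W.exists_isTorsionBasis_two
  obtain ⟨p, rfl, hp⟩ := exists_halves W.exists_add_self_eq ((two_smul ℕ P).symm.trans h.left)
  obtain ⟨q, rfl, hq⟩ := exists_halves W.exists_add_self_eq ((two_smul ℕ Q).symm.trans h.right)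
  exact ⟨p, q, hp, hq, h.pow_two hp hq⟩

end WeierstrassCurve

end

/-! ### Correcting automorphisms along the 2-power cyclotomic tower -/

noncomputable section

lemma isPrimitiveRoot_of_pow_eq_neg_one {K : Type*} [Field K] [NeZero (2 : K)] {ζ : K} {m : ℕ}
    (h : ζ ^ 2 ^ m = -1) : IsPrimitiveRoot ζ (2 ^ (m + 1)) := by
  rw [IsPrimitiveRoot.iff_orderOf]
  refine orderOf_eq_prime_pow ?_ (by rw [pow_succ, pow_mul, h, neg_one_sq])
  rw [h]
  intro h1
  refine NeZero.ne (2 : K) ?_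
  linear_combination -h1

lemma IsPrimitiveRoot.map_eq_of_map_eq {F K : Type*} [Field F] [Field K] [Algebra F K] {n : ℕ}
    [NeZero n] {ζ ξ : K} (hζ : IsPrimitiveRoot ζ n) (hξ : ξ ^ n = 1) {σ : K ≃ₐ[F] K}
    (h : σ ζ = ζ) : σ ξ = ξ := by
  obtain ⟨i, -, rfl⟩ := hζ.eq_pow_of_pow_eq_one hξ
  rw [map_pow, h]

lemma exists_tower_roots (K : Type*) [Field K] [IsAlgClosed K] [NeZero (2 : K)] :
    ∃ z : ℕ → K, z 1 = -1 ∧ (∀ m, z (m + 1) ^ 2 = z m) ∧ ∀ m, IsPrimitiveRoot (z m) (2 ^ m) := by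
  choose f hf using fun a : K => IsAlgClosed.exists_pow_nat_eq a two_pos
  refine ⟨fun m => Nat.casesOn m 1 fun k => f^[k] (-1), rfl, ?_, ?_⟩
  · rintro (_ | m)
    · exact neg_one_sq
    · change f^[m + 1] (-1) ^ 2 = f^[m] (-1)
      rw [Function.iterate_succ_apply', hf]
  · rintro (_ | m)
    · simp
    · refine isPrimitiveRoot_of_pow_eq_neg_one ?_
      change f^[m] (-1) ^ 2 ^ m = -1
      induction m with
      | zero => simp
      | succ m ih => rw [Function.iterate_succ_apply', pow_succ', pow_mul, hf, ih]

section Galois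

variable {F K : Type*} [Field F] [Field K] [Algebra F K] [NeZero (2 : K)] {z : ℕ → K}
  (z1 : z 1 = -1) (hz : ∀ m, z (m + 1) ^ 2 = z m) (hprim : ∀ m, IsPrimitiveRoot (z m) (2 ^ m))

include hprim in
lemma map_root_of_le {σ : K ≃ₐ[F] K} {m k : ℕ} (hk : k ≤ m) (h : σ (z m) = z m) :
    σ (z k) = z k := by
  refine (hprim m).map_eq_of_map_eq ?_ h
  rw [← Nat.sub_add_cancel hk, pow_add, mul_comm, pow_mul, (hprim k).pow_eq_one, one_pow]

include hz in
lemma map_root_succ {σ : K ≃ₐ[F] K} {m : ℕ} (h : σ (z m) = z m) :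
    σ (z (m + 1)) = z (m + 1) ∨ σ (z (m + 1)) = -z (m + 1) := by
  rw [← sq_eq_sq_iff_eq_or_eq_neg, ← map_pow, hz, h]

include z1 hz hprim in
-- Here σ multiplies z(m + 2) by a square root of -1, namely ± z 2. As m ≥ 2, σ fixes z 2, so σ²
-- multiplies z(m + 2) by (z 2)² = -1. This is where j > 2 enters.
lemma map_root_sq {σ : K ≃ₐ[F] K} {m : ℕ} (hm : 2 ≤ m) (h0 : σ (z m) = z m)
    (h1 : σ (z (m + 1)) = -z (m + 1)) :
    (σ ^ 2) (z (m + 1)) = z (m + 1) ∧ (σ ^ 2) (z (m + 2)) = -z (m + 2) := by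
  have h2 : σ (z 2) = z 2 := map_root_of_le hprim hm h0
  have hi : z 2 ^ 2 = -1 := by rw [hz 1, z1]
  rw [pow_two, AlgEquiv.mul_apply, AlgEquiv.mul_apply]
  refine ⟨by rw [h1, map_neg, h1, neg_neg], ?_⟩
  have h3 : σ (z (m + 2)) ^ 2 = (z 2 * z (m + 2)) ^ 2 := by
    rw [← map_pow, hz (m + 1), h1, mul_pow, hi, hz (m + 1), neg_one_mul]
  rcases sq_eq_sq_iff_eq_or_eq_neg.mp h3 with h | h
  · rw [h, map_mul, h, h2]
    linear_combination z (m + 2) * hi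
  · rw [h, map_neg, map_mul, h, h2]
    linear_combination z (m + 2) * hi

include z1 hz hprim in
/-- An automorphism fixing `μ_{2^j}` can be corrected, without changing its image in a group of
exponent dividing `6`, so as to fix `μ_{2^m}`. -/
lemma exists_correction {N : Type*} [Group N] (hN : ∀ x : N, x ^ 6 = 1) (ρ : (K ≃ₐ[F] K) →* N)
    {j : ℕ} (hj : 2 ≤ j) {κ : K ≃ₐ[F] K} (hκ : κ (z j) = z j) (hκ' : κ (z (j + 1)) ≠ z (j + 1))
    {σ : K ≃ₐ[F] K} (hσ : σ (z (j + 1)) = z (j + 1)) {m : ℕ} (hm : j + 1 ≤ m) :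
    ∃ τ : K ≃ₐ[F] K, ρ τ = ρ σ ∧ τ (z m) = z m := by
  have hκ1 : κ (z (j + 1)) = -z (j + 1) := (map_root_succ hz hκ).resolve_left hκ'
  -- Elements of ker ρ that move exactly the next level of the tower. The base case is the square of
  -- κ³: an odd power still negates z(j + 1), and the square κ⁶ lies in the kernel.
  have key : ∀ m, j + 1 ≤ m → ∃ τ : K ≃ₐ[F] K, ρ τ = 1 ∧ τ (z m) = z m ∧
      τ (z (m + 1)) = -z (m + 1) := by
    intro m hm
    induction m, hm using Nat.le_induction with
    | base =>
      have h3 : (κ ^ 3) (z j) = z j ∧ (κ ^ 3) (z (j + 1)) = -z (j + 1) := by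
        simp only [pow_succ, pow_zero, one_mul, AlgEquiv.mul_apply, hκ, hκ1, map_neg, neg_neg,
          and_self]
      refine ⟨(κ ^ 3) ^ 2, ?_, map_root_sq z1 hz hprim hj h3.1 h3.2⟩
      rw [← pow_mul, map_pow, hN]
    | succ m hm ih =>
      obtain ⟨τ, h1, h2, h3⟩ := ih
      refine ⟨τ ^ 2, ?_, map_root_sq z1 hz hprim (by omega) h2 h3⟩
      rw [map_pow, h1, one_pow]
  induction m, hm using Nat.le_induction with
  | base => exact ⟨σ, rfl, hσ⟩
  | succ m hm ih =>
    obtain ⟨τ, h1, h2⟩ := ih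
    rcases map_root_succ hz h2 with h3 | h3
    · exact ⟨τ, h1, h3⟩
    · obtain ⟨τ', h1', h2', h3'⟩ := key m hm
      refine ⟨τ * τ', by rw [map_mul, h1, h1', mul_one], ?_⟩
      rw [AlgEquiv.mul_apply, h3', map_neg, h3, neg_neg]

end Galois

/-- The set is empty or a left coset of an open stabiliser. -/
lemma isClosed_setOf_apply_eq {F K : Type*} [Field F] [Field K] [Algebra F K]
    [Algebra.IsIntegral F K] (a b : K) : IsClosed {σ : K ≃ₐ[F] K | σ a = b} := by
  by_cases h : ∃ τ : K ≃ₐ[F] K, τ a = b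
  · obtain ⟨τ, rfl⟩ := h
    have h1 : IsClosed (MulAction.stabilizer (K ≃ₐ[F] K) a : Set (K ≃ₐ[F] K)) :=
      Subgroup.isClosed_of_isOpen _ (stabilizer_isOpen_of_isIntegral a)
    convert h1.preimage (continuous_const_mul τ⁻¹) using 1
    ext σ
    change σ • a = τ • a ↔ (τ⁻¹ * σ) • a = a
    rw [mul_smul, inv_smul_eq_iff]
  · convert isClosed_empty
    ext σ
    simp only [Set.mem_ofPred_eq, Set.mem_empty_iff_false, iff_false]
    exact fun h' => h ⟨σ, h'⟩

lemma mem_galCyclotomicTower {F : Type*} [Field F] {ℓ : ℕ} [NeZero ℓ] {z : ℕ → SepCl F}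
    (hprim : ∀ m, IsPrimitiveRoot (z m) (ℓ ^ m)) {σ : AbsGal F} (h : ∀ m, σ (z m) = z m) :
    σ ∈ galCyclotomicTower F ℓ := by
  rw [galCyclotomicTower, ← Subgroup.zpowers_le, ← IntermediateField.le_iff_le, cyclotomicTower,
    IntermediateField.adjoin_le_iff]
  rintro ξ ⟨m, hm⟩ ⟨τ, hτ⟩
  obtain ⟨k, rfl⟩ := Subgroup.mem_zpowers_iff.mp hτ
  have h1 : σ ∈ MulAction.stabilizer (AbsGal F) ξ := (hprim m).map_eq_of_map_eq hm (h m)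
  exact zpow_mem h1 k

end

/-! ### Linear algebra over F_2 and transvections in the image of Galois -/

noncomputable section

lemma exists_algEquiv_apply_ne {F : Type*} [Field F] [CharZero F] {a b : SepCl F}
    (h : b ∉ IntermediateField.adjoin F {a}) : ∃ κ : AbsGal F, κ a = a ∧ κ b ≠ b := by
  by_contra! H
  refine h ?_
  rw [← InfiniteGalois.fixedField_fixingSubgroup (IntermediateField.adjoin F {a})]
  rintro ⟨κ, hκ⟩
  exact H κ (hκ ⟨a, IntermediateField.mem_adjoin_simple_self F a⟩)

lemma IsTorsionBasis.smul {A : Type*} [AddCommGroup A] {n h : ℕ} (hn : n ≠ 0) (hh : h ≠ 0)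
    {P Q : A} (hPQ : IsTorsionBasis (n * h) P Q) : IsTorsionBasis n (h • P) (h • Q) where
  left := by rw [← mul_smul, hPQ.left]
  right := by rw [← mul_smul, hPQ.right]
  span R hR := by
    obtain ⟨a, b, rfl⟩ := hPQ.span R (by rw [mul_comm, mul_smul, hR, smul_zero])
    have h1 : ((n : ℤ) * a) • P + ((n : ℤ) * b) • Q = 0 := by
      rw [mul_smul, mul_smul, ← smul_add, natCast_zsmul, hR]
    have hn' : (n : ℤ) ≠ 0 := by exact_mod_cast hn
    obtain ⟨h2, h3⟩ := hPQ.indep _ _ h1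
    rw [Nat.cast_mul] at h2 h3
    obtain ⟨a, rfl⟩ := (mul_dvd_mul_iff_left hn').mp h2
    obtain ⟨b, rfl⟩ := (mul_dvd_mul_iff_left hn').mp h3
    exact ⟨a, b, by rw [mul_comm, mul_smul, mul_comm, mul_smul, natCast_zsmul, natCast_zsmul]⟩
  indep a b hab := by
    rw [← natCast_zsmul, ← natCast_zsmul, ← mul_smul, ← mul_smul] at hab
    have hh' : (h : ℤ) ≠ 0 := by exact_mod_cast hh
    obtain ⟨h2, h3⟩ := hPQ.indep _ _ hab
    rw [Nat.cast_mul] at h2 h3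
    exact ⟨(mul_dvd_mul_iff_right hh').mp h2, (mul_dvd_mul_iff_right hh').mp h3⟩

section TwoDimensional

variable {M : Type*} [AddCommGroup M] [Module (ZMod 2) M] (b : Module.Basis (Fin 2) (ZMod 2) M)

include b

lemma linearEquiv_pow_six (e : M ≃ₗ[ZMod 2] M) : e ^ 6 = 1 := by
  -- GL_2(F_2) is isomorphic to S_3; B only witnesses that A is invertible.
  have key : ∀ A B : Matrix (Fin 2) (Fin 2) (ZMod 2), A * B = 1 → A ^ 6 = 1 := by decide
  have h1 : (e : M →ₗ[ZMod 2] M) ^ 6 = 1 := by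
    apply (LinearMap.toMatrixAlgEquiv b).injective
    rw [map_pow, map_one]
    refine key _ (LinearMap.toMatrixAlgEquiv b e.symm) ?_
    rw [← map_mul, Module.End.mul_eq_comp, LinearEquiv.comp_coe, LinearEquiv.symm_trans_self]
    exact map_one (LinearMap.toMatrixAlgEquiv b)
  ext x
  exact LinearMap.congr_fun h1 x

lemma subgroup_eq_top_of_transvections {H : Subgroup (M ≃ₗ[ZMod 2] M)} {u l : M ≃ₗ[ZMod 2] M}
    (hu : u ∈ H) (hl : l ∈ H) (u0 : u (b 0) = b 0) (u1 : u (b 1) = b 1 + b 0)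
    (l0 : l (b 0) = b 0 + b 1) (l1 : l (b 1) = b 1) : H = ⊤ := by
  let U : Matrix (Fin 2) (Fin 2) (ZMod 2) := !![1, 1; 0, 1]
  let L : Matrix (Fin 2) (Fin 2) (ZMod 2) := !![1, 0; 1, 1]
  -- All six elements of GL_2(F_2), as words in the two transvections.
  have key : ∀ A B : Matrix (Fin 2) (Fin 2) (ZMod 2), A * B = 1 → A = 1 ∨ A = U ∨ A = L ∨
    A = U * L ∨ A = L * U ∨ A = U * L * U := by decide
  let φ := LinearMap.toMatrixAlgEquiv b
  have hU : φ u = U := by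
    ext i k
    rw [LinearMap.toMatrixAlgEquiv_apply]
    fin_cases i <;> fin_cases k <;> simp [u0, u1, U]
  have hL : φ l = L := by
    ext i k
    rw [LinearMap.toMatrixAlgEquiv_apply]
    fin_cases i <;> fin_cases k <;> simp [l0, l1, L]
  have hinj : ∀ f g : M ≃ₗ[ZMod 2] M, φ f = φ g → f = g := fun f g h =>
    LinearEquiv.toLinearMap_injective (φ.injective h)
  have hmul : ∀ f g : M ≃ₗ[ZMod 2] M, φ (f * g : M ≃ₗ[ZMod 2] M) = φ f * φ g := fun f g =>
    map_mul φ (f : M →ₗ[ZMod 2] M) (g : M →ₗ[ZMod 2] M)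
  have hone : φ (1 : M ≃ₗ[ZMod 2] M) = 1 := map_one φ
  rw [Subgroup.eq_top_iff']
  intro f
  rcases key (φ f) (φ (f⁻¹ : M ≃ₗ[ZMod 2] M)) (by rw [← hmul, mul_inv_cancel, hone])
    with h | h | h | h | h | h
  · rw [hinj f 1 (by rw [h, hone])]
    exact one_mem H
  · rwa [hinj f u (by rw [h, hU])]
  · rwa [hinj f l (by rw [h, hL])]
  · rw [hinj f (u * l) (by rw [h, hmul, hU, hL])]
    exact mul_mem hu hl
  · rw [hinj f (l * u) (by rw [h, hmul, hU, hL])]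
    exact mul_mem hl hu
  · rw [hinj f (u * l * u) (by rw [h, hmul, hmul, hU, hL])]
    exact mul_mem (mul_mem hu hl) hu

end TwoDimensional

namespace WeierstrassCurve

variable {F : Type u} [Field F] (E : WeierstrassCurve F)

lemma isClosed_setOf_map_point_eq [Algebra.IsIntegral F (SepCl F)] (P R : E.SepPoint) :
    IsClosed {σ : AbsGal F |
      Affine.Point.map (W' := E) (σ : SepCl F →ₐ[F] SepCl F) P = R} := by
  rcases P with _ | ⟨x, y, h⟩
  · exact (isClosed_const : IsClosed {_σ : AbsGal F | (0 : E.SepPoint) = R})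
  · rcases R with _ | ⟨x', y', h'⟩
    · convert isClosed_empty
      ext σ
      simp only [Set.mem_ofPred_eq, Set.mem_empty_iff_false, iff_false]
      exact Affine.Point.some_ne_zero _
    · convert (isClosed_setOf_apply_eq (F := F) x x').inter
        (isClosed_setOf_apply_eq (F := F) y y') using 1
      ext σ
      simp only [Set.mem_ofPred_eq, Affine.Point.map_some, Affine.Point.some.injEq,
        Set.mem_inter_iff]
      rfl

variable {E} in
lemma exists_basis_of_isTorsionBasis {n : ℕ} {P Q : E.SepPoint} (h : IsTorsionBasis n P Q) :
    ∃ b : Module.Basis (Fin 2) (ZMod n) (E.Tors n), (b 0 : E.SepPoint) = P ∧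
      (b 1 : E.SepPoint) = Q := by
  have hP : (n : ℤ) • P = 0 := by rw [natCast_zsmul, h.left]
  have hQ : (n : ℤ) • Q = 0 := by rw [natCast_zsmul, h.right]
  let v : Fin 2 → E.Tors n := ![⟨P, hP⟩, ⟨Q, hQ⟩]
  have hli : LinearIndependent (ZMod n) v := by
    rw [LinearIndependent.pair_iff]
    intro s t hst
    obtain ⟨s, rfl⟩ := ZMod.intCast_surjective s
    obtain ⟨t, rfl⟩ := ZMod.intCast_surjective t
    rw [Int.cast_smul_eq_zsmul, Int.cast_smul_eq_zsmul] at hst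
    rw [ZMod.intCast_zmod_eq_zero_iff_dvd, ZMod.intCast_zmod_eq_zero_iff_dvd]
    exact h.indep _ _ (congrArg Subtype.val hst)
  have hsp : ⊤ ≤ Submodule.span (ZMod n) (Set.range v) := by
    rintro ⟨R, hR⟩ -
    have hR' : n • R = 0 := by rw [← natCast_zsmul]; exact hR
    obtain ⟨s, t, rfl⟩ := h.span R hR'
    rw [Submodule.mem_span_range_iff_exists_fun]
    refine ⟨![(s : ZMod n), (t : ZMod n)], ?_⟩
    rw [Fin.sum_univ_two]
    change (s : ZMod n) • (⟨P, hP⟩ : E.Tors n) + (t : ZMod n) • (⟨Q, hQ⟩ : E.Tors n) = _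
    rw [Int.cast_smul_eq_zsmul, Int.cast_smul_eq_zsmul]
    rfl
  refine ⟨Module.Basis.mk hli hsp, ?_, ?_⟩ <;> rw [Module.Basis.mk_apply] <;> rfl

lemma exists_map_eq_transvection {n : ℕ} (hSL : E.slTors n ≤ (E.modRep n).range)
    {P Q : E.SepPoint} (h : IsTorsionBasis n P Q) : ∃ σ : AbsGal F,
      Affine.Point.map (W' := E) (σ : SepCl F →ₐ[F] SepCl F) P = P ∧
      Affine.Point.map (W' := E) (σ : SepCl F →ₐ[F] SepCl F) Q = Q + P := by
  obtain ⟨b, rfl, rfl⟩ := exists_basis_of_isTorsionBasis h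
  have hdet : (!![1, 1; 0, 1] : Matrix (Fin 2) (Fin 2) (ZMod n)).det = 1 := by
    simp [Matrix.det_fin_two]
  let f := Matrix.toLinearEquiv b !![1, 1; 0, 1] (by rw [hdet]; exact isUnit_one)
  have hf : ∀ x, f x = Matrix.toLin b b !![1, 1; 0, 1] x := fun x => rfl
  obtain ⟨σ, hσ⟩ := hSL (x := f) (by
    rw [E.mem_slTors_iff n b]
    exact (congrArg Matrix.det (LinearMap.toMatrix_toLin b b _)).trans hdet)
  refine ⟨σ, ?_, ?_⟩
  · rw [← coe_modRep, hσ, hf, Matrix.toLin_self, Fin.sum_univ_two]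
    simp only [Matrix.of_apply, Matrix.cons_val_zero, Matrix.cons_val_one, one_smul, zero_smul,
      add_zero]
  · rw [← coe_modRep, hσ, hf, Matrix.toLin_self, Fin.sum_univ_two]
    simp only [Matrix.of_apply, Matrix.cons_val_zero, Matrix.cons_val_one, one_smul]
    exact add_comm _ _

end WeierstrassCurve

end

/-! ### Transvections of E_2 realised over the cyclotomic tower -/

noncomputable section

namespace WeierstrassCurve

/-- A Galois automorphism acting on the `2 ^ (k + 1)`-torsion as a transvection fixes the roots of
unity of order `2 ^ (k + 1)`. -/
theorem exists_pow_eq_neg_one_of_transvection {F K : Type*} [Field F] [Field K] [Algebra F K]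
    [dec : DecidableEq K] [IsAlgClosed K] [NeZero (2 : K)] (E : WeierstrassCurve F) [E.IsElliptic]
    {k : ℕ} {P Q : (E⁄K).toAffine.Point} (h : IsTorsionBasis (2 ^ (k + 1)) P Q) (σ : K ≃ₐ[F] K)
    (hσP : Affine.Point.map (W' := E) (σ : K →ₐ[F] K) P = P)
    (hσQ : Affine.Point.map (W' := E) (σ : K →ₐ[F] K) Q = Q + P) :
    ∃ ζ : K, ζ ^ 2 ^ k = -1 ∧ σ ζ = ζ := by
  -- The group law on points depends on a decidable equality; any instance equals the classical one.
  obtain rfl : dec = fun a b => Classical.propDecidable (a = b) := Subsingleton.elim _ _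
  obtain ⟨G⟩ := nonempty_genericPoint E K
  have hdiv := (E⁄K).exists_add_self_eq
  have hiter : ∀ m : ℕ, ∃ P', 2 ^ m • P' = P := by
    intro m
    induction m with
    | zero => exact ⟨P, one_smul ℕ P⟩
    | succ m ih =>
      obtain ⟨P', hP'⟩ := ih
      obtain ⟨P'', rfl⟩ := hdiv P'
      exact ⟨P'', by rw [pow_succ, mul_smul, two_smul, hP']⟩
  obtain ⟨P', hP'⟩ := hiter (k + 1)
  exact G.exists_pow_eq_neg_one hdiv h hP' (by ring) (by positivity) σ hσP hσQ

/-- Compatible bases of the torsion of `2`-power order, for an arbitrary decidable equality. -/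
theorem exists_compatible_torsionBases {K : Type*} [Field K] [dec : DecidableEq K]
    [IsAlgClosed K] [NeZero (2 : K)] (W : WeierstrassCurve K) [W.IsElliptic] :
    ∃ p q : ℕ → W.toAffine.Point, (∀ m, 2 • p (m + 1) = p m) ∧ (∀ m, 2 • q (m + 1) = q m) ∧
      ∀ m, IsTorsionBasis (2 ^ m) (p m) (q m) := by
  obtain rfl : dec = fun a b => Classical.propDecidable (a = b) := Subsingleton.elim _ _
  exact W.exists_isTorsionBasis_pow_two

variable {F : Type u} [Field F] [CharZero F] (E : WeierstrassCurve F) [E.IsElliptic]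

/-- The transvections attached to a basis of the `2 ^ (k + 1)`-torsion are realised on the
`2`-torsion by automorphisms fixing all roots of unity of `2`-power order. -/
theorem exists_mem_galCyclotomicTower_transvection {k : ℕ} (hk : 2 ≤ k) {ζ ζ' : SepCl F}
    (hζ : IsPrimitiveRoot ζ (2 ^ (k + 1))) (hζ' : IsPrimitiveRoot ζ' (2 ^ k))
    (hnot : ζ ∉ IntermediateField.adjoin F {ζ'})
    (hSL : E.slTors (2 ^ (k + 1)) ≤ (E.modRep (2 ^ (k + 1))).range) {P Q : E.SepPoint}
    (h : IsTorsionBasis (2 ^ (k + 1)) P Q) : ∃ τ ∈ galCyclotomicTower F 2,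
      Affine.Point.map (W' := E) (τ : SepCl F →ₐ[F] SepCl F) (2 ^ k • P) = 2 ^ k • P ∧
      Affine.Point.map (W' := E) (τ : SepCl F →ₐ[F] SepCl F) (2 ^ k • Q) =
        2 ^ k • Q + 2 ^ k • P := by
  obtain ⟨z, z1, hz, hprim⟩ := exists_tower_roots (SepCl F)
  obtain ⟨κ, hκ, hκ'⟩ := exists_algEquiv_apply_ne hnot
  obtain ⟨σ, hσP, hσQ⟩ := E.exists_map_eq_transvection hSL h
  obtain ⟨ξ, hξ, hσξ⟩ := exists_pow_eq_neg_one_of_transvection E h σ hσP hσQ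
  have hσ : σ (z (k + 1)) = z (k + 1) :=
    (isPrimitiveRoot_of_pow_eq_neg_one hξ).map_eq_of_map_eq (hprim (k + 1)).pow_eq_one hσξ
  have hκz : κ (z k) = z k := hζ'.map_eq_of_map_eq (hprim k).pow_eq_one hκ
  have hκz' : κ (z (k + 1)) ≠ z (k + 1) := fun h0 =>
    hκ' ((hprim (k + 1)).map_eq_of_map_eq hζ.pow_eq_one h0)
  have h1 : IsTorsionBasis 2 (2 ^ k • P) (2 ^ k • Q) :=
    IsTorsionBasis.smul two_ne_zero (by positivity) (by rwa [← pow_succ'])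
  obtain ⟨b, hb0, hb1⟩ := exists_basis_of_isTorsionBasis h1
  -- Decreasing nonempty closed subsets of the compact group G_F; a common element fixes all roots
  -- of unity of 2-power order.
  let S : ℕ → Set (AbsGal F) := fun m =>
    ({τ | Affine.Point.map (W' := E) (τ : SepCl F →ₐ[F] SepCl F) (2 ^ k • P) = 2 ^ k • P} ∩
    {τ | Affine.Point.map (W' := E) (τ : SepCl F →ₐ[F] SepCl F) (2 ^ k • Q) =
        2 ^ k • Q + 2 ^ k • P}) ∩ {τ | τ (z (k + 1 + m)) = z (k + 1 + m)}
  have hclosed : ∀ m, IsClosed (S m) := fun m =>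
    ((E.isClosed_setOf_map_point_eq _ _).inter (E.isClosed_setOf_map_point_eq _ _)).inter
      (isClosed_setOf_apply_eq _ _)
  obtain ⟨τ, hτ⟩ := IsCompact.nonempty_iInter_of_sequence_nonempty_isCompact_isClosed S
    (fun m τ hτ => ⟨hτ.1, map_root_of_le hprim (Nat.le_succ _) hτ.2⟩)
    (fun m => by
      obtain ⟨τ, hτ, hτz⟩ := exists_correction z1 hz hprim (linearEquiv_pow_six b) (E.modRep 2)
        hk hκz hκz' hσ (Nat.le_add_right (k + 1) m)
      have hact : ∀ R : E.Tors 2,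
          Affine.Point.map (W' := E) (τ : SepCl F →ₐ[F] SepCl F) (R : E.SepPoint) =
            Affine.Point.map (W' := E) (σ : SepCl F →ₐ[F] SepCl F) (R : E.SepPoint) := fun R => by
        rw [← coe_modRep, hτ, coe_modRep]
      refine ⟨τ, ⟨?_, ?_⟩, hτz⟩
      · change Affine.Point.map (W' := E) (τ : SepCl F →ₐ[F] SepCl F) _ = _
        rw [← hb0, hact, hb0, map_nsmul, hσP]
      · change Affine.Point.map (W' := E) (τ : SepCl F →ₐ[F] SepCl F) _ = _
        rw [← hb1, hact, hb1, map_nsmul, hσQ, smul_add])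
    (hclosed 0).isCompact hclosed
  rw [Set.mem_iInter] at hτ
  exact ⟨τ, mem_galCyclotomicTower hprim fun m =>
    map_root_of_le hprim (Nat.le_add_left m (k + 1)) (hτ m).2, (hτ 0).1.1, (hτ 0).1.2⟩

end WeierstrassCurve

end

/-! ### Nakayama's lemma and a basis of the Tate module -/

noncomputable section

section Nakayama

variable {M N : Type*} [AddCommGroup M] [Module ℤ_[2] M] [Group N]
  (B : Module.Basis (Fin 2) ℤ_[2] M)

/-- The reduction mod `2` of the matrix of an endomorphism of a free `ℤ₂`-module of rank two. -/
def matrixModTwo : Module.End ℤ_[2] M →+* Matrix (Fin 2) (Fin 2) (ZMod 2) :=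
  (PadicInt.toZMod (p := 2)).mapMatrix.comp (LinearMap.toMatrixAlgEquiv B : _ →+* _)

lemma matrixModTwo_apply (f : Module.End ℤ_[2] M) (i k : Fin 2) :
    matrixModTwo B f i k = PadicInt.toZMod (B.repr (f (B k)) i) := by
  simp [matrixModTwo, LinearMap.toMatrixAlgEquiv_apply]

lemma matrixModTwo_apply_of_eq {f : Module.End ℤ_[2] M} {k : Fin 2} {x y : M}
    (h : f (B k) = x + (2 : ℕ) • y) (i : Fin 2) :
    matrixModTwo B f i k = PadicInt.toZMod (B.repr x i) := by
  rw [matrixModTwo_apply, h, map_add, map_nsmul, Finsupp.add_apply, Finsupp.smul_apply, map_add,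
    map_nsmul, ← Nat.cast_smul_eq_nsmul (ZMod 2), ZMod.natCast_self, zero_smul, add_zero]

lemma mem_smul_top_of_matrixModTwo_eq_zero {f : Module.End ℤ_[2] M} (h : matrixModTwo B f = 0) :
    f ∈ IsLocalRing.maximalIdeal ℤ_[2] • (⊤ : Submodule ℤ_[2] (Module.End ℤ_[2] M)) := by
  have h1 : ∀ i k, LinearMap.toMatrixAlgEquiv B f i k ∈ IsLocalRing.maximalIdeal ℤ_[2] := by
    intro i k
    rw [← PadicInt.ker_toZMod, RingHom.mem_ker]
    exact congrFun (congrFun h i) k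
  rw [← (LinearMap.toMatrixAlgEquiv B).symm_apply_apply f,
    Matrix.matrix_eq_sum_single (LinearMap.toMatrixAlgEquiv B f), map_sum]
  refine Submodule.sum_mem _ fun i _ => ?_
  rw [map_sum]
  refine Submodule.sum_mem _ fun k _ => ?_
  rw [← mul_one (LinearMap.toMatrixAlgEquiv B f i k), ← smul_eq_mul, ← Matrix.smul_single, map_smul]
  exact Submodule.smul_mem_smul (h1 i k) Submodule.mem_top

include B in
/-- A representation on a free `ℤ₂`-module of rank two whose reduction contains the two elementary
transvections generates the whole endomorphism algebra. -/
theorem asAlgebraHom_surjective_of_transvections {ρ : Representation ℤ_[2] N M} {u l : N}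
    {y₁ y₂ y₃ y₄ : M} (u0 : ρ u (B 0) = B 0 + (2 : ℕ) • y₁)
    (u1 : ρ u (B 1) = B 1 + B 0 + (2 : ℕ) • y₂) (l0 : ρ l (B 0) = B 0 + B 1 + (2 : ℕ) • y₃)
    (l1 : ρ l (B 1) = B 1 + (2 : ℕ) • y₄) : Function.Surjective ρ.asAlgebraHom := by
  let U : Matrix (Fin 2) (Fin 2) (ZMod 2) := !![1, 1; 0, 1]
  let L : Matrix (Fin 2) (Fin 2) (ZMod 2) := !![1, 0; 1, 1]
  -- The matrices 1, U, L, UL span M_2(F_2), so the image of the group ring is everything modulo the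
  -- maximal ideal.
  have key : ∀ A : Matrix (Fin 2) (Fin 2) (ZMod 2), ∃ a b c d : Fin 2,
    A = a.val • 1 + b.val • U + c.val • L + d.val • (U * L) := by decide
  have hU : matrixModTwo B (ρ u) = U := by
    ext i k
    fin_cases k
    · exact (matrixModTwo_apply_of_eq B u0 i).trans (by fin_cases i <;> simp [U])
    · exact (matrixModTwo_apply_of_eq B u1 i).trans (by fin_cases i <;> simp [U])
  have hL : matrixModTwo B (ρ l) = L := by
    ext i k
    fin_cases k
    · exact (matrixModTwo_apply_of_eq B l0 i).trans (by fin_cases i <;> simp [L])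
    · exact (matrixModTwo_apply_of_eq B l1 i).trans (by fin_cases i <;> simp [L])
  have : Module.Finite ℤ_[2] M := .of_basis B
  have : Module.Free ℤ_[2] M := .of_basis B
  have hmem : ∀ g, ρ g ∈ LinearMap.range ρ.asAlgebraHom.toLinearMap := fun g =>
    ⟨MonoidAlgebra.of _ _ g, ρ.asAlgebraHom_of g⟩
  have htop : (⊤ : Submodule ℤ_[2] (Module.End ℤ_[2] M)) ≤
      LinearMap.range ρ.asAlgebraHom.toLinearMap := by
    refine Submodule.le_of_le_smul_of_le_jacobson_bot
      (I := IsLocalRing.maximalIdeal ℤ_[2]) Module.Finite.fg_top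
      (IsLocalRing.maximalIdeal_le_jacobson _) fun f _ => ?_
    obtain ⟨a, b, c, d, h⟩ := key (matrixModTwo B f)
    let g : Module.End ℤ_[2] M :=
      a.val • ρ 1 + b.val • ρ u + c.val • ρ l + d.val • ρ (u * l)
    have hg : matrixModTwo B g = matrixModTwo B f := by
      simp only [g, map_add, map_nsmul, map_mul, map_one, hU, hL, h]
    rw [← add_sub_cancel g f]
    refine Submodule.add_mem_sup ?_ (mem_smul_top_of_matrixModTwo_eq_zero B
      (by rw [map_sub, hg, sub_self]))
    exact add_mem (add_mem (add_mem (nsmul_mem (hmem _) _) (nsmul_mem (hmem _) _))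
      (nsmul_mem (hmem _) _)) (nsmul_mem (hmem _) _)
  intro f
  exact htop (Submodule.mem_top (x := f))

end Nakayama

namespace WeierstrassCurve

variable {F : Type u} [Field F] {E : WeierstrassCurve F}

lemma exists_tors_coe_eq {n : ℕ} {P : E.SepPoint} (h : n • P = 0) :
    ∃ R : E.Tors n, (R : E.SepPoint) = P :=
  ⟨⟨P, (natCast_zsmul P n).trans h⟩, rfl⟩

lemma nsmul_coe_tors {n : ℕ} (P : E.Tors n) : n • (P : E.SepPoint) = 0 :=
  (natCast_zsmul _ n).symm.trans P.2

lemma coe_intCast_smul {n : ℕ} (k : ℤ) (P : E.Tors n) :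
    (((k : ZMod n) • P : E.Tors n) : E.SepPoint) = k • (P : E.SepPoint) := by
  rw [Int.cast_smul_eq_zsmul]
  rfl

section Tate

variable {ℓ : ℕ} [Fact ℓ.Prime]

lemma coe_padic_smul {m : ℕ} {a : ℤ_[ℓ]} {k : ℤ} (h : PadicInt.toZModPow m a = k)
    (P : E.Tors (ℓ ^ m)) :
    ((a • P : E.Tors (ℓ ^ m)) : E.SepPoint) = k • (P : E.SepPoint) := by
  rw [padic_smul_def, h]
  exact coe_intCast_smul k P

lemma tateModule_nsmul_apply (k : ℕ) (x : E.tateModule ℓ) (m : ℕ) :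
    (((k • x).1 m : E.Tors (ℓ ^ m)) : E.SepPoint) = k • (x.1 m : E.SepPoint) := by
  induction k with
  | zero => rw [zero_smul, zero_smul]; rfl
  | succ k ih => rw [succ_nsmul, succ_nsmul, ← ih]; rfl

lemma exists_tateModule_coe_eq {p : ℕ → E.SepPoint} (h : ∀ m, ℓ ^ m • p m = 0)
    (hp : ∀ m, ℓ • p (m + 1) = p m) : ∃ x : E.tateModule ℓ, ∀ m, (x.1 m : E.SepPoint) = p m := by
  choose R hR using fun m => exists_tors_coe_eq (h m)
  refine ⟨⟨R, fun m => ?_⟩, hR⟩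
  rw [hR, hR, hp]

/-- The shifted sequence m ↦ x(m + 1) is the quotient by ℓ; vanishing at level 1 puts its terms in
the right torsion groups. -/
lemma exists_eq_nsmul_of_tateModule_one_eq_zero (x : E.tateModule ℓ)
    (hx : (x.1 1 : E.SepPoint) = 0) : ∃ y, x = ℓ • y := by
  have h : ∀ m, ℓ ^ m • (x.1 (m + 1) : E.SepPoint) = 0 := by
    intro m
    induction m with
    | zero => rw [pow_zero, one_smul]; exact hx
    | succ m ih => rw [pow_succ, mul_smul]; exact (congrArg _ (x.2 (m + 1))).trans ih
  obtain ⟨y, hy⟩ := exists_tateModule_coe_eq (p := fun m => (x.1 (m + 1) : E.SepPoint)) h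
    fun m => x.2 (m + 1)
  refine ⟨y, Subtype.ext (funext fun m => Subtype.ext ?_)⟩
  rw [tateModule_nsmul_apply, hy]
  exact (x.2 m).symm

/-- Compatible bases of the `ℓ ^ m`-torsion form a basis of the Tate module. -/
lemma exists_basis_tateModule {p q : ℕ → E.SepPoint}
    (hp : ∀ m, ℓ • p (m + 1) = p m) (hq : ∀ m, ℓ • q (m + 1) = q m)
    (h : ∀ m, IsTorsionBasis (ℓ ^ m) (p m) (q m)) :
    ∃ B : Module.Basis (Fin 2) ℤ_[ℓ] (E.tateModule ℓ),
      (∀ m, ((B 0).1 m : E.SepPoint) = p m) ∧ ∀ m, ((B 1).1 m : E.SepPoint) = q m := by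
  obtain ⟨x₀, hx₀⟩ := exists_tateModule_coe_eq (fun m => (h m).left) hp
  obtain ⟨x₁, hx₁⟩ := exists_tateModule_coe_eq (fun m => (h m).right) hq
  have hcomb : ∀ (a b : ℤ_[ℓ]) (m : ℕ) (s t : ℤ), PadicInt.toZModPow m a = s →
      PadicInt.toZModPow m b = t →
      ((a • x₀ + b • x₁).1 m : E.SepPoint) = s • p m + t • q m := by
    intro a b m s t hs ht
    rw [← hx₀, ← hx₁, ← coe_padic_smul hs, ← coe_padic_smul ht]
    rfl
  have hli : LinearIndependent ℤ_[ℓ] ![x₀, x₁] := by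
    rw [LinearIndependent.pair_iff]
    intro a b hab
    have h1 : ∀ m, PadicInt.toZModPow m a = 0 ∧ PadicInt.toZModPow m b = 0 := by
      intro m
      obtain ⟨s, hs⟩ := ZMod.intCast_surjective (PadicInt.toZModPow m a)
      obtain ⟨t, ht⟩ := ZMod.intCast_surjective (PadicInt.toZModPow m b)
      have h2 := hcomb a b m s t hs.symm ht.symm
      rw [hab] at h2
      rw [← hs, ← ht, ZMod.intCast_zmod_eq_zero_iff_dvd, ZMod.intCast_zmod_eq_zero_iff_dvd]
      exact (h m).indep _ _ h2.symm
    exact ⟨PadicInt.ext_of_toZModPow.mp fun m => by rw [(h1 m).1, map_zero],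
      PadicInt.ext_of_toZModPow.mp fun m => by rw [(h1 m).2, map_zero]⟩
  have hsp : ⊤ ≤ Submodule.span ℤ_[ℓ] (Set.range ![x₀, x₁]) := by
    rintro x -
    -- The coordinates at level m are determined modulo ℓ^m, so these integers form Cauchy sequences
    -- whose limits are the ℓ-adic coordinates of x.
    choose f g hfg using fun m => (h m).span _ (nsmul_coe_tors (x.1 m))
    have hdvd : ∀ m, (ℓ : ℤ) ^ m ∣ f (m + 1) - f m ∧ (ℓ : ℤ) ^ m ∣ g (m + 1) - g m := by
      intro m
      rw [← Nat.cast_pow]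
      refine (h m).indep _ _ ?_
      have h1 := x.2 m
      rw [hfg, hfg, smul_add, smul_comm, hp, smul_comm, hq] at h1
      rw [sub_smul, sub_smul, sub_add_sub_comm, h1, sub_self]
    rw [Submodule.mem_span_range_iff_exists_fun]
    refine ⟨![PadicInt.ofIntSeq f
      (PadicInt.isCauSeq_padicNorm_of_pow_dvd_sub f ℓ fun m => (hdvd m).1),
      PadicInt.ofIntSeq g
      (PadicInt.isCauSeq_padicNorm_of_pow_dvd_sub g ℓ fun m => (hdvd m).2)], ?_⟩
    rw [Fin.sum_univ_two]
    refine Subtype.ext (funext fun m => Subtype.ext ?_)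
    rw [hfg]
    exact hcomb _ _ m _ _ (PadicInt.toZModPow_ofIntSeq_of_pow_dvd_sub f ℓ (fun m => (hdvd m).1) m)
      (PadicInt.toZModPow_ofIntSeq_of_pow_dvd_sub g ℓ (fun m => (hdvd m).2) m)
  refine ⟨Module.Basis.mk hli hsp, fun m => ?_, fun m => ?_⟩
  · rw [Module.Basis.mk_apply]
    exact hx₀ m
  · rw [Module.Basis.mk_apply]
    exact hx₁ m

end Tate

end WeierstrassCurve

end

/-- The rank clause guarantees that `slTors 2` is SL_2(F_2): on a module without a finite basis the
determinant would take the default value 1. -/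
theorem mainTheorem8 {F : Type*} [Field F] [NumberField F]
    (E : WeierstrassCurve F) [E.IsElliptic] (j : ℕ) (hj : 2 < j)
    (ζ ζ' : SepCl F) (hζ : IsPrimitiveRoot ζ (2 ^ j)) (hζ' : IsPrimitiveRoot ζ' (2 ^ (j - 1)))
    (hnot : ζ ∉ IntermediateField.adjoin F {ζ'})
    (hSL : E.slTors (2 ^ j) ≤ (E.modRep (2 ^ j)).range) :
    (Module.finrank (ZMod 2) (E.Tors 2) = 2 ∧
      (galCyclotomicTower F 2).map (E.modRep 2) = E.slTors 2) ∧
    E.IsFull 2 := by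
  obtain ⟨k, rfl⟩ : ∃ k, j = k + 1 := ⟨j - 1, by omega⟩
  rw [Nat.add_sub_cancel] at hζ'
  have hk : 2 ≤ k := by omega
  obtain ⟨p, q, hp, hq, hpq⟩ := WeierstrassCurve.exists_compatible_torsionBases (E⁄(SepCl F))
  have hiter : ∀ r : ℕ → E.SepPoint, (∀ m, 2 • r (m + 1) = r m) → ∀ m, 2 ^ m • r (m + 1) = r 1 := by
    intro r hr m
    induction m with
    | zero => rw [pow_zero, one_smul]
    | succ m ih => rw [pow_succ, mul_smul, hr, ih]
  obtain ⟨u, hu, u0, u1⟩ :=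
    E.exists_mem_galCyclotomicTower_transvection hk hζ hζ' hnot hSL (hpq (k + 1))
  -- The same result for the swapped basis gives the other transvection.
  obtain ⟨l, hl, l1, l0⟩ :=
    E.exists_mem_galCyclotomicTower_transvection hk hζ hζ' hnot hSL (hpq (k + 1)).symm
  rw [hiter p hp] at u0 u1 l0
  rw [hiter q hq] at u1 l0 l1
  refine ⟨?_, ?_⟩
  · have h1 : IsTorsionBasis 2 (p 1) (q 1) := hpq 1
    obtain ⟨b, hb0, hb1⟩ := WeierstrassCurve.exists_basis_of_isTorsionBasis h1
    have hcoe : ∀ σ ∈ galCyclotomicTower F 2, E.modRep 2 σ ∈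
        (galCyclotomicTower F 2).map (E.modRep 2) := fun σ hσ => Subgroup.mem_map_of_mem _ hσ
    refine ⟨by rw [Module.finrank_eq_card_basis b, Fintype.card_fin], ?_⟩
    have hunits : ∀ a : (ZMod 2)ˣ, a = 1 := by decide
    have htop : E.slTors 2 = ⊤ := (Subgroup.eq_top_iff' _).mpr fun f => hunits _
    rw [htop]
    refine subgroup_eq_top_of_transvections b (hcoe u hu) (hcoe l hl) ?_ ?_ ?_ ?_ <;>
      refine Subtype.ext ?_ <;> rw [WeierstrassCurve.coe_modRep]
    · rw [hb0, u0]
    · rw [hb1, u1, ← hb0, ← hb1]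
      rfl
    · rw [hb0, l0, ← hb0, ← hb1]
      rfl
    · rw [hb1, l1]
  · obtain ⟨B, hB0, hB1⟩ := WeierstrassCurve.exists_basis_tateModule hp hq hpq
    -- The action on level 1 of the Tate module determines the action modulo 2.
    have key : ∀ (σ : AbsGal F) (x y : E.tateModule 2),
        WeierstrassCurve.Affine.Point.map (W' := E) (σ : SepCl F →ₐ[F] SepCl F)
          (x.1 1 : E.SepPoint) = (y.1 1 : E.SepPoint) →
        ∃ w, E.tateRep 2 σ x = y + (2 : ℕ) • w := by
      intro σ x y h
      obtain ⟨w, hw⟩ := WeierstrassCurve.exists_eq_nsmul_of_tateModule_one_eq_zero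
        (E.tateRep 2 σ x - y) (by
          change WeierstrassCurve.Affine.Point.map (W' := E) (σ : SepCl F →ₐ[F] SepCl F)
            (x.1 1 : E.SepPoint) - (y.1 1 : E.SepPoint) = 0
          rw [h, sub_self])
      exact ⟨w, by rw [← hw, add_sub_cancel]⟩
    have hadd : ∀ x y : E.tateModule 2,
        ((x + y).1 1 : E.SepPoint) = (x.1 1 : E.SepPoint) + (y.1 1 : E.SepPoint) :=
      fun x y => rfl
    obtain ⟨y₁, h1⟩ := key u (B 0) (B 0) (by rw [hB0, u0])
    obtain ⟨y₂, h2⟩ := key u (B 1) (B 1 + B 0) (by rw [hadd, hB0, hB1, u1])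
    obtain ⟨y₃, h3⟩ := key l (B 0) (B 0 + B 1) (by rw [hadd, hB0, hB1, l0])
    obtain ⟨y₄, h4⟩ := key l (B 1) (B 1) (by rw [hB1, l1])
    exact ⟨.of_basis B, .of_basis B, B.repr.toEquiv.nontrivial,
      asAlgebraHom_surjective_of_transvections B (u := ⟨u, hu⟩) (l := ⟨l, hl⟩) h1 h2 h3 h4⟩
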